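/- Let $G$ be a simply connected, nilpotent, non-commutative complex Lie group of dimension $n$, and let $\Gamma\subset G$ be a discrete subgroup such that $X=G/\Gamma$ is compact. Give $X$ the complex structure for which the projection $\pi:G\to X$ is a local biholomorphism; then $\pi$ is the universal covering of $X$, with deck group $\Gamma$ acting on $G$ by right translations $\gamma\cdot g=g\gamma^{-1}$. Then: 1. the holomorphic tangent bundle $T_X$ is trivial; 2. $G$ is isomorphic to $\mathbf{C}^n$ as a complex manifold; 3. for no isomorphism of complex manifolds $\varphi:G\to\mathbf{C}^n$ is the action of $\Gamma$ on $\mathbf{C}^n$ transported by $\varphi$ diagonal; that is, there do not exist actions of $\Gamma$ on the $n$ factors $\mathbf{C}$ such that $\varphi(\varphi^{-1}(z)\gamma^{-1})=(\gamma\cdot z_1,\dots,\gamma\cdot z_n)$ for all $\gamma\in\Gamma$ and $z\in\mathbf{C}^n$. Moreover, every connected nilpotent subgroup of the group $\mathrm{Aut}(\mathbf{C})$ of biholomorphic automorphisms of $\mathbf{C}$ (with the topology of uniform convergence on compact sets) is commutative. -/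

import Mathlib

open scoped Manifold ContDiff

namespace ComplexNil

section Quotient

variable {E : Type*} [NormedAddCommGroup E] [NormedSpace ℂ E]
  {G : Type*} [TopologicalSpace G] [ChartedSpace E G] [Group G]

/-- The projection of a complex Lie group to its quotient by a discrete subgroup is a local
homeomorphism. -/
theorem isLocalHomeomorph_mk (E : Type*) [NormedAddCommGroup E] [NormedSpace ℂ E]
    {G : Type*} [TopologicalSpace G] [ChartedSpace E G] [Group G] [LieGroup 𝓘(ℂ, E) ω G]
    (Γ : Subgroup G) [DiscreteTopology Γ] :
    IsLocalHomeomorph (QuotientGroup.mk : G → G ⧸ Γ) := by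
  have : IsTopologicalGroup G := topologicalGroup_of_lieGroup 𝓘(ℂ, E) ω
  exact (Γ.isQuotientCoveringMap
    (isDiscrete_iff_discreteTopology.mpr inferInstance)).isCoveringMap.isLocalHomeomorph

/-- The complex atlas on `G ⧸ Γ`, for `Γ` a discrete subgroup of the complex Lie group `G`: its
charts are the local inverses of the projection followed by the charts of `G`. -/
noncomputable instance instChartedSpaceQuotient [LieGroup 𝓘(ℂ, E) ω G]
    (Γ : Subgroup G) [DiscreteTopology Γ] : ChartedSpace E (G ⧸ Γ) :=
  (isLocalHomeomorph_mk E Γ).chartedSpace QuotientGroup.mk_surjective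

/-- The quotient of a complex Lie group by a discrete subgroup is a complex manifold. -/
instance instIsManifoldQuotient [LieGroup 𝓘(ℂ, E) ω G]
    (Γ : Subgroup G) [DiscreteTopology Γ] : IsManifold 𝓘(ℂ, E) ω (G ⧸ Γ) := by
  have : IsTopologicalGroup G := topologicalGroup_of_lieGroup 𝓘(ℂ, E) ω
  have hf := isLocalHomeomorph_mk E Γ
  apply isManifold_of_contDiffOn
  rintro e e' ⟨p, rfl⟩ ⟨q, rfl⟩
  generalize (QuotientGroup.mk_surjective (s := Γ)).hasRightInverse.choose p = a
  generalize (QuotientGroup.mk_surjective (s := Γ)).hasRightInverse.choose q = b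
  intro x hx
  apply ContDiffAt.contDiffWithinAt
  rw [← contMDiffAt_iff_contDiffAt]
  simp only [OpenPartialHomeomorph.trans_symm_eq_symm_trans_symm, Set.mem_inter_iff,
    Set.mem_preimage, OpenPartialHomeomorph.trans_source, OpenPartialHomeomorph.symm_source,
    OpenPartialHomeomorph.coe_trans, modelWithCornersSelf_coe,
    modelWithCornersSelf_coe_symm, Function.comp_apply, id_eq, Set.range_id, Set.mem_univ,
    and_true, IsLocalHomeomorph.localInverseAt_symm] at hx
  obtain ⟨⟨hx1, hx2⟩, hx3, hx4⟩ := hx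
  have hca : ContMDiffAt 𝓘(ℂ, E) 𝓘(ℂ, E) ω (chartAt E a).symm x :=
    (contMDiffOn_chart_symm (I := 𝓘(ℂ, E)) (n := ω) (x := a)).contMDiffAt
      ((chartAt E a).open_target.mem_nhds hx1)
  set y : G := (chartAt E a).symm x with hy
  set γ : G := y⁻¹ * hf.localInverseAt b (QuotientGroup.mk y) with hγ
  have hyγ : y * γ = hf.localInverseAt b (QuotientGroup.mk y) := by simp [hγ]
  have hγΓ : γ ∈ Γ := by
    rw [hγ, ← QuotientGroup.eq]
    exact (hf.apply_localInverseAt_of_mem hx3).symm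
  have hsm : ContMDiffAt 𝓘(ℂ, E) 𝓘(ℂ, E) ω
      (fun z ↦ chartAt E b ((chartAt E a).symm z * γ)) x := by
    have h1 : ContMDiffAt 𝓘(ℂ, E) 𝓘(ℂ, E) ω (fun z ↦ (chartAt E a).symm z * γ) x :=
      hca.mul contMDiffAt_const
    have h2 : ContMDiffAt 𝓘(ℂ, E) 𝓘(ℂ, E) ω (chartAt E b) ((chartAt E a).symm x * γ) := by
      refine (contMDiffOn_chart (I := 𝓘(ℂ, E)) (n := ω) (x := b)).contMDiffAt
        ((chartAt E b).open_source.mem_nhds ?_)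
      rw [← hy, hyγ]; exact hx4
    exact ContMDiffAt.comp x h2 h1
  refine hsm.congr_of_eventuallyEq ?_
  have hev : ∀ᶠ z in nhds x, (chartAt E a).symm z * γ ∈ (hf.localInverseAt b).target := by
    have hc : ContinuousAt (fun z ↦ (chartAt E a).symm z * γ) x :=
      hca.continuousAt.mul continuousAt_const
    refine hc.eventually ((hf.localInverseAt b).open_target.mem_nhds ?_)
    show y * γ ∈ _
    rw [hyγ]
    exact (hf.localInverseAt b).map_source hx3
  filter_upwards [hev] with z hz
  have hmk : (QuotientGroup.mk ((chartAt E a).symm z) : G ⧸ Γ)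
      = QuotientGroup.mk ((chartAt E a).symm z * γ) := by
    rw [QuotientGroup.eq]; simpa using hγΓ
  have hinv : hf.localInverseAt b (QuotientGroup.mk ((chartAt E a).symm z * γ))
      = (chartAt E a).symm z * γ := by
    have := (hf.localInverseAt b).right_inv hz
    rwa [hf.localInverseAt_symm] at this
  simp only [OpenPartialHomeomorph.trans_symm_eq_symm_trans_symm,
    OpenPartialHomeomorph.coe_trans, modelWithCornersSelf_coe,
    modelWithCornersSelf_coe_symm, Function.comp_apply, id_eq,
    IsLocalHomeomorph.localInverseAt_symm]
  rw [hmk, hinv]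

end Quotient

/-- The holomorphic tangent bundle of the complex manifold `M` is trivial: it is isomorphic, as a
holomorphic vector bundle, to the product bundle `M × E`. -/
def TangentBundleIsTrivial (E : Type*) [NormedAddCommGroup E] [NormedSpace ℂ E]
    (M : Type*) [TopologicalSpace M] [ChartedSpace E M] [IsManifold 𝓘(ℂ, E) ω M] : Prop :=
  ∃ Φ : TangentBundle 𝓘(ℂ, E) M ≃ₘ^ω⟮𝓘(ℂ, E).tangent, 𝓘(ℂ, E).prod 𝓘(ℂ, E)⟯ (M × E),
    (∀ v, (Φ v).1 = v.proj) ∧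
    ∀ x : M, IsLinearMap ℂ (fun v : TangentSpace 𝓘(ℂ, E) x ↦ (Φ ⟨x, v⟩).2)

/-- An action `a` of a group on a product `∏ i, U i` is diagonal: the group acts on each factor
`U i`, and `a` is the product of these actions. -/
def ActsDiagonally {K : Type*} [Group K] {ι : Type*} {U : ι → Type*}
    (a : K →* Equiv.Perm (∀ i, U i)) : Prop :=
  ∃ ρ : ∀ i, K →* Equiv.Perm (U i), ∀ k u i, a k u i = ρ i k (u i)

/-- The action of `Γ` on `G` by right translations `g ↦ g * γ⁻¹` (the deck transformations of
`G → G ⧸ Γ`), transported to `Y` by a bijection `G ≃ Y`. -/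
def transportedDeckAction {G Y : Type*} [Group G] (Γ : Subgroup G) (φ : G ≃ Y) :
    Γ →* Equiv.Perm Y where
  toFun γ := (φ.symm.trans (Equiv.mulRight (γ : G)⁻¹)).trans φ
  map_one' := by ext; simp
  map_mul' γ δ := by ext; simp [mul_assoc]

/-- `Aut(ℂ)`, the group of biholomorphic maps `ℂ → ℂ`. -/
def AutC : Subgroup (ℂ ≃ₜ ℂ) where
  carrier := {f | Differentiable ℂ f ∧ Differentiable ℂ f.symm}
  one_mem' := ⟨differentiable_id, differentiable_id⟩
  mul_mem' hf hg := ⟨hf.1.comp hg.1, hg.2.comp hf.2⟩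
  inv_mem' hf := ⟨hf.2, hf.1⟩

/-- `Aut(ℂ)` carries the topology of uniform convergence on compact sets. -/
noncomputable instance : TopologicalSpace AutC :=
  TopologicalSpace.induced (fun f ↦ (⟨f.1, f.1.continuous⟩ : C(ℂ, ℂ))) inferInstance

end ComplexNil

/-!
The proof avoids the exponential map and the general structure theory of Lie groups.

*`G` is biholomorphic to `ℂⁿ`.* Closed connected subgroups of `G` are replaced by holomorphic
retracts (`IsHolomorphicRetract`): subgroups `K` with a holomorphic map `r : G → G` which has values
in `K` and is the identity on `K`. Suppose that `K` has positive dimension. Since `G` is nilpotent,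
the operators `Ad k - 1`, which are the derivatives of the commutator maps, act nilpotently on the
tangent space of `K` at the identity, so some nonzero linear form `ℓ` on it is `Ad`-invariant
(`IsHolomorphicRetract.exists_invariant_functional`). The translation invariant one-form with value
`ℓ` at the identity is then invariant on both sides. It is closed: the inversion pulls it back to
its negative, so its exterior derivative vanishes at the identity, and translations carry this to
all other points. Since `G` is simply connected, the form has a global primitive, which restricts to
a homomorphism `f : K → ℂ` (`IsHolomorphicRetract.exists_homomorphism`). A section `σ` of `f` is the
one-parameter group `lim c(t / 2ⁿ) ^ 2ⁿ` of a curve `c` in `K` with `ℓ (c' 0) = 1`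
(`exists_tendsto_pow_two_pow`, `IsHolomorphicRetract.exists_section`). Now `g ↦ r g * (σ (f g))⁻¹`
is a retraction onto the kernel of `f` in `K`, of smaller dimension, and an induction starting with
`K = G` produces the coordinates (`IsHolomorphicRetract.exists_coordinates`).

*The tangent bundle is trivial.* `G` acts on the left on `G ⧸ Γ`, and the vector fields generated by
this action form a frame (`tangentBundleIsTrivial_quotient`).

*No diagonal action.* If `Γ` acts diagonally, it acts on every factor `ℂ` by biholomorphic maps,
which are affine (`exists_eq_affine_of_mem_AutC`). A nilpotent group acting by affine maps of the
line acts through a commutative group (`commute_of_affine_action`), which also gives the statement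
on subgroups of `Aut(ℂ)`. Hence `Γ` is commutative. For `γ ∈ Γ` the map `g ↦ g * γ * g⁻¹` then
descends to the compact manifold `G ⧸ Γ` and is constant because `G` is biholomorphic to `ℂⁿ`; so
`Γ` is central. Now the commutator maps `h ↦ a * h * a⁻¹ * h⁻¹` descend as well, and `G` is
commutative (`commute_of_commute_discrete_subgroup`).
-/

namespace ComplexNil

/-! ### Automorphisms of the complex line -/

open Filter Topology in
/-- An entire function of at most linear growth is affine, by Cauchy's estimate for its
derivative. -/
theorem exists_eq_affine_of_linear_growth {g : ℂ → ℂ} (hg : Differentiable ℂ g) {A : ℝ}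
    (hA : ∀ z, ‖g z‖ ≤ A * (1 + ‖z‖)) : ∃ a b : ℂ, ∀ z, g z = a * z + b := by
  have hA0 : 0 ≤ A := by simpa using (norm_nonneg _).trans (hA 0)
  have hbound : ∀ z, ‖deriv g z‖ ≤ 2 * A := by
    intro z
    have hR : (0 : ℝ) < 1 + ‖z‖ := by positivity
    have h := Complex.norm_deriv_le_of_forall_mem_sphere_norm_le (c := z) (f := g)
      (C := A * (2 * (1 + ‖z‖))) hR hg.diffContOnCl (by
        intro w hw
        refine (hA w).trans (mul_le_mul_of_nonneg_left ?_ hA0)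
        have : ‖w‖ ≤ ‖w - z‖ + ‖z‖ := by simpa using norm_add_le (w - z) z
        rw [mem_sphere_iff_norm] at hw
        linarith)
    refine h.trans (le_of_eq ?_)
    field_simp
  have hconst : ∀ z w, deriv g z = deriv g w := fun z w ↦
    (hg.contDiff (n := 2)).differentiable_deriv_two.apply_eq_apply_of_bounded
      (isBounded_iff_forall_norm_le.mpr ⟨2 * A, by rintro _ ⟨z, rfl⟩; exact hbound z⟩) z w
  refine ⟨deriv g 0, g 0, fun z ↦ ?_⟩
  have hk : ∀ z, HasDerivAt (fun z ↦ g z - deriv g 0 * z) 0 z := by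
    intro z
    have := (hg z).hasDerivAt.fun_sub ((hasDerivAt_id z).const_mul (deriv g 0))
    simpa [hconst z 0] using this
  have := is_const_of_deriv_eq_zero (fun z ↦ (hk z).differentiableAt) (fun z ↦ (hk z).deriv) z 0
  simp only [mul_zero, sub_zero] at this
  rw [← this]; ring

open Filter Topology in
/-- A biholomorphic map of the complex line is affine. After a translation it vanishes exactly at
the origin, so `z / f z` extends to an entire function without zeros; it has linear growth because
`f` tends to infinity at infinity, hence it is affine, hence constant. -/
theorem exists_eq_affine_of_mem_AutC {f : ℂ ≃ₜ ℂ} (hf : f ∈ AutC) :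
    ∃ a b : ℂ, a ≠ 0 ∧ ∀ z, f z = a * z + b := by
  obtain ⟨hd, hd'⟩ := hf
  set F : ℂ → ℂ := fun z ↦ f z - f 0 with hF
  have hFd : Differentiable ℂ F := hd.sub_const _
  have hF0 : F 0 = 0 := by simp [hF]
  have hFne : ∀ z, z ≠ 0 → F z ≠ 0 := fun z hz h ↦
    hz (f.injective (sub_eq_zero.mp h))
  have hderiv : deriv F 0 ≠ 0 := by
    intro h0
    have h1 : HasDerivAt f (deriv f 0) 0 := (hd 0).hasDerivAt
    have h2 : HasDerivAt f.symm (deriv f.symm (f 0)) (f 0) := (hd' _).hasDerivAt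
    have h3 := h2.comp (0 : ℂ) h1
    have h4 : (f.symm ∘ f : ℂ → ℂ) = id := by ext z; simp
    rw [h4] at h3
    have h5 := h3.unique (hasDerivAt_id 0)
    have h6 : deriv f 0 = 0 := by simpa [hF] using h0
    simp [h6] at h5
  set q : ℂ → ℂ := dslope F 0 with hq
  have hqd : Differentiable ℂ q := by
    rw [← differentiableOn_univ]
    exact (Complex.differentiableOn_dslope Filter.univ_mem).mpr hFd.differentiableOn
  have hqz : ∀ z, z ≠ 0 → q z = F z / z := by
    intro z hz
    rw [hq, dslope_of_ne _ hz, slope_def_field, hF0, sub_zero, sub_zero]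
  have hqne : ∀ z, q z ≠ 0 := by
    intro z
    by_cases hz : z = 0
    · subst hz; simpa [hq] using hderiv
    · rw [hqz z hz]; exact div_ne_zero (hFne z hz) hz
  set g : ℂ → ℂ := fun z ↦ (q z)⁻¹ with hg
  have hgd : Differentiable ℂ g := fun z ↦ (hqd z).inv (hqne z)
  have hlarge : ∀ᶠ z in cocompact ℂ, ‖g z‖ ≤ 1 * (1 + ‖z‖) := by
    have h1 : Tendsto f (cocompact ℂ) (cocompact ℂ) := f.isClosedEmbedding.tendsto_cocompact
    have h2 : Tendsto (fun z ↦ ‖f z‖) (cocompact ℂ) atTop := tendsto_norm_cocompact_atTop.comp h1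
    filter_upwards [h2.eventually_ge_atTop (‖f 0‖ + 1)] with z hz
    have hFz : 1 ≤ ‖F z‖ := by
      have := norm_sub_norm_le (f z) (f 0)
      simp only [hF]; linarith
    by_cases hz0 : z = 0
    · rw [hz0] at hFz; simp [hF0] at hFz; linarith
    · simp only [hg]
      rw [hqz z hz0, inv_div, norm_div]
      have := div_le_self (norm_nonneg z) hFz
      linarith
  obtain ⟨A, hA⟩ : ∃ A, ∀ z, ‖g z‖ ≤ A * (1 + ‖z‖) := by
    obtain ⟨t, ht, hts⟩ := Filter.mem_cocompact.mp hlarge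
    obtain ⟨B, hB⟩ := ht.exists_bound_of_continuousOn hgd.continuous.continuousOn
    refine ⟨max B 1, fun z ↦ ?_⟩
    have h1 : (1 : ℝ) ≤ 1 + ‖z‖ := by simp
    by_cases hz : z ∈ t
    · calc ‖g z‖ ≤ B := hB z hz
        _ ≤ max B 1 := le_max_left _ _
        _ ≤ max B 1 * (1 + ‖z‖) := le_mul_of_one_le_right (by positivity) h1
    · refine (hts hz : ‖g z‖ ≤ 1 * (1 + ‖z‖)).trans ?_
      gcongr
      exact le_max_right _ _
  obtain ⟨a, b, hab⟩ := exists_eq_affine_of_linear_growth hgd hA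
  have hgne : ∀ z, g z ≠ 0 := fun z ↦ inv_ne_zero (hqne z)
  have ha : a = 0 := by
    by_contra ha
    apply hgne (-b / a)
    rw [hab]; field_simp; ring
  have hb : b ≠ 0 := by simpa [hab, ha] using hgne 0
  refine ⟨b⁻¹, f 0, inv_ne_zero hb, fun z ↦ ?_⟩
  by_cases hz : z = 0
  · simp [hz]
  · have h1 : g z = b := by simp [hab, ha]
    have h2 : q z = b⁻¹ := by rw [← h1]; simp [hg]
    rw [hqz z hz, div_eq_iff hz] at h2
    rw [← h2]; simp [hF]

open scoped commutatorElement in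
/-- In a nilpotent group, a group of affine transformations of the line cannot contain both a
nontrivial translation and a map of multiplier `m ≠ 1`: iterated commutators would be the
translations by `(m - 1) ^ n * t`. So either all multipliers are `1`, or the action is through its
multipliers. -/
theorem commute_of_affine_action {N : Type*} [Group N] [Group.IsNilpotent N]
    (ρ : N →* Equiv.Perm ℂ) (hρ : ∀ n, ∃ m t : ℂ, m ≠ 0 ∧ ∀ z, ρ n z = m * z + t) (a b : N) :
    ρ a * ρ b = ρ b * ρ a := by
  -- the commutator with a map of multiplier `m` multiplies a translation vector by `m - 1`
  have hcomm : ∀ x y : N, ∀ m t s : ℂ, m ≠ 0 → (∀ z, ρ x z = z + t) → (∀ z, ρ y z = m * z + s) →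
      ∀ z, ρ ⁅x, y⁆ z = z + (1 - m) * t := by
    intro x y m t s hm hx hy z
    have hx' : ∀ z, (ρ x)⁻¹ z = z - t := fun z ↦ by
      rw [Equiv.Perm.inv_eq_iff_eq, hx]; ring
    have hy' : ∀ z, (ρ y)⁻¹ z = (z - s) / m := fun z ↦ by
      rw [Equiv.Perm.inv_eq_iff_eq, hy]; field_simp; ring
    rw [commutatorElement_def]
    simp only [map_mul, map_inv, Equiv.Perm.mul_apply, hx, hx', hy, hy']
    field_simp
    ring
  have hdich : ∀ x y : N, ∀ m t s : ℂ, m ≠ 0 → (∀ z, ρ x z = z + t) →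
      (∀ z, ρ y z = m * z + s) → t = 0 ∨ m = 1 := by
    intro x y m t s hm hx hy
    have key : ∀ n, ∃ w ∈ Subgroup.lowerCentralSeries (⊤ : Subgroup N) n,
        ∀ z, ρ w z = z + (1 - m) ^ n * t := by
      intro n
      induction n with
      | zero => exact ⟨x, by simp, by simpa using hx⟩
      | succ n ih =>
        obtain ⟨w, hw, hwt⟩ := ih
        refine ⟨⁅w, y⁆, ?_, fun z ↦ ?_⟩
        · exact Subgroup.commutator_mem_commutator hw (Subgroup.mem_top y)
        · rw [hcomm w y m _ s hm hwt hy z]; ring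
    obtain ⟨n, hn⟩ := Subgroup.nilpotent_iff_lowerCentralSeries.mp
      (inferInstance : Group.IsNilpotent N)
    obtain ⟨w, hw, hwt⟩ := key n
    rw [hn, Subgroup.mem_bot] at hw
    have h0 := hwt 0
    simp only [hw, map_one, Equiv.Perm.coe_one, id_eq, zero_add] at h0
    rcases mul_eq_zero.mp h0.symm with h | h
    · exact Or.inr (sub_eq_zero.mp (eq_zero_of_pow_eq_zero h)).symm
    · exact Or.inl h
  obtain ⟨m, t, hm, ha⟩ := hρ a
  obtain ⟨m', t', hm', hb⟩ := hρ b
  have htrans : ∀ z, ρ ⁅a, b⁆ z = z + ((1 - m') * t - (1 - m) * t') := by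
    intro z
    have ha' : ∀ z, (ρ a)⁻¹ z = (z - t) / m := fun z ↦ by
      rw [Equiv.Perm.inv_eq_iff_eq, ha]; field_simp; ring
    have hb' : ∀ z, (ρ b)⁻¹ z = (z - t') / m' := fun z ↦ by
      rw [Equiv.Perm.inv_eq_iff_eq, hb]; field_simp; ring
    rw [commutatorElement_def]
    simp only [map_mul, map_inv, Equiv.Perm.mul_apply, ha, ha', hb, hb']
    field_simp
    ring
  ext z
  simp only [Equiv.Perm.mul_apply, ha, hb]
  rcases hdich _ a m _ t hm htrans ha with h | h
  · linear_combination h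
  rcases hdich _ b m' _ t' hm' htrans hb with h' | h'
  · linear_combination h'
  rw [h, h']; ring

/-- Every nilpotent subgroup of `Aut(ℂ)` is commutative. -/
theorem commute_of_isNilpotent_subgroup_AutC (H : Subgroup AutC) [Group.IsNilpotent H]
    {a b : AutC} (ha : a ∈ H) (hb : b ∈ H) : a * b = b * a := by
  let ρ : H →* Equiv.Perm ℂ :=
    { toFun := fun h ↦ h.1.1.toEquiv
      map_one' := rfl
      map_mul' := fun _ _ ↦ rfl }
  have h := commute_of_affine_action ρ (fun h ↦ by
    obtain ⟨m, t, hm, h'⟩ := exists_eq_affine_of_mem_AutC h.1.2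
    exact ⟨m, t, hm, h'⟩) ⟨a, ha⟩ ⟨b, hb⟩
  apply Subtype.ext
  ext z
  exact DFunLike.congr_fun h z

end ComplexNil

namespace ComplexNil

/-! ### Gluing local primitives on a simply connected space -/

open Filter Topology in
/-- On a simply connected, locally path-connected space, functions given locally, any two of which
differ by a locally constant function, come from a global function: the fibre bundle of their
integration constants has a discrete fibre, so it is a covering and has a section. -/
theorem exists_global_of_locally_constant_differences {X A : Type*} [TopologicalSpace X]
    [SimplyConnectedSpace X] [LocallyPathConnectedSpace X] [AddCommGroup A]
    (U : X → Set X) (hU : ∀ x, IsOpen (U x)) (hxU : ∀ x, x ∈ U x) (H : X → X → A)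
    (hH : ∀ x y, ∀ z ∈ U x ∩ U y, ∀ᶠ w in 𝓝 z, H x w - H y w = H x z - H y z) :
    ∃ f : X → A, ∀ x, ∀ z ∈ U x, ∀ᶠ w in 𝓝 z, f w - H x w = f z - H x z := by
  let _ : TopologicalSpace A := ⊥
  have : DiscreteTopology A := ⟨rfl⟩
  let Z : FiberBundleCore X X A :=
    { baseSet := U
      isOpen_baseSet := hU
      indexAt := id
      mem_baseSet_at := hxU
      coordChange := fun i j x v ↦ v + (H i x - H j x)
      coordChange_self := fun i x _ v ↦ by simp
      continuousOn_coordChange := fun i j ↦ by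
        rintro ⟨z, v⟩ ⟨hz, -⟩
        apply ContinuousAt.continuousWithinAt
        have h1 : ContinuousAt (fun x ↦ H i x - H j x) z :=
          (continuousAt_const (y := H i z - H j z)).congr
            ((hH i j z hz).mono fun _ h ↦ h.symm)
        exact ContinuousAt.comp (f := fun p : X × A ↦ (p.2, H i p.1 - H j p.1))
          (g := fun p : A × A ↦ p.1 + p.2) continuous_of_discreteTopology.continuousAt
          (continuousAt_snd.prodMk (ContinuousAt.comp (f := Prod.fst) (x := (z, v)) h1
            continuousAt_fst))
      coordChange_comp := fun i j k x _ v ↦ by abel }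
  have hcov : IsCoveringMap (Bundle.TotalSpace.proj : Z.TotalSpace → X) :=
    FiberBundle.isCoveringMap
  obtain ⟨x₀⟩ : Nonempty X := inferInstance
  obtain ⟨s, ⟨-, hs⟩, -⟩ := hcov.existsUnique_continuousMap_lifts (ContinuousMap.id X) x₀
    (⟨x₀, (0 : A)⟩ : Z.TotalSpace) rfl
  have hs1 : ∀ x, (s x).proj = x := fun x ↦ congrFun hs x
  let v : X → A := fun x ↦ (s x).2
  refine ⟨fun x ↦ v x + H x x, fun x z hz ↦ ?_⟩
  have hcont : ContinuousAt (fun w ↦ (Z.localTriv x (s w)).2) z := by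
    refine continuousAt_snd.comp (ContinuousAt.comp ?_ s.continuous.continuousAt)
    refine (Z.localTriv x).continuousOn_toFun.continuousAt
      ((Z.localTriv x).open_source.mem_nhds ?_)
    rw [FiberBundleCore.mem_localTriv_source, hs1]
    exact hz
  have hval : ∀ w, (Z.localTriv x (s w)).2 = v w + H w w - H x w := by
    intro w
    rw [FiberBundleCore.localTriv_apply]
    show v w + (H (s w).proj (s w).proj - H x (s w).proj) = _
    rw [hs1, add_sub_assoc]
  have := hcont.eventually ((isOpen_discrete {(Z.localTriv x (s z)).2}).mem_nhds rfl)
  filter_upwards [this] with w hw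
  rw [← hval, ← hval]
  exact hw

end ComplexNil

namespace ComplexNil

/-! ### Iterating the doubling map -/

section Doubling

open Filter Topology Metric

variable {E : Type*} [NormedAddCommGroup E] [NormedSpace ℂ E]

/-- Near a fixed point where the derivative is multiplication by `2`, the map `x ↦ S x - 2 x` is
Lipschitz on small balls with constant proportional to the radius. -/
theorem exists_lipschitz_sub_two_smul {S : E → E} (hS : ContDiffAt ℂ 2 S 0)
    (hS' : fderiv ℂ S 0 = (2 : ℂ) • ContinuousLinearMap.id ℂ E) :
    ∃ C > 0, ∃ ρ > 0, (∀ x, ‖x‖ < ρ → DifferentiableAt ℂ S x) ∧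
      ∀ R < ρ, ∀ x y, ‖x‖ ≤ R → ‖y‖ ≤ R → ‖S x - S y‖ ≤ (2 + C * R) * ‖x - y‖ := by
  have hd : DifferentiableAt ℂ (fderiv ℂ S) 0 :=
    (hS.fderiv_right (m := 1) (by norm_num)).differentiableAt (by norm_num)
  obtain ⟨C, hC, hb⟩ := (hd.isBigO_sub).exists_pos
  rw [Asymptotics.IsBigOWith] at hb
  have hdiff : ∀ᶠ x in 𝓝 (0 : E), DifferentiableAt ℂ S x :=
    (hS.eventually (by simp)).mono fun x hx ↦ hx.differentiableAt (by norm_num)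
  obtain ⟨ρ, hρ, hball⟩ := Metric.eventually_nhds_iff.mp (hb.and hdiff)
  refine ⟨C, hC, ρ, hρ, fun x hx ↦ (hball (by simpa using hx)).2, fun R hR x y hx hy ↦ ?_⟩
  have hR0 : 0 ≤ R := (norm_nonneg x).trans hx
  have key := (convex_closedBall (0 : E) R).norm_image_sub_le_of_norm_hasFDerivWithin_le
    (𝕜 := ℂ) (f := fun z ↦ S z) (f' := fun z ↦ fderiv ℂ S z) (C := 2 + C * R) (x := y) (y := x)
    (fun z hz ↦ ((hball (lt_of_le_of_lt (by simpa using hz) hR)).2.hasFDerivAt).hasFDerivWithinAt)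
    (fun z hz ↦ ?_) (by simpa using hy) (by simpa using hx)
  · exact key
  · have hz' : ‖z‖ ≤ R := by simpa using hz
    have h1 := (hball (y := z) (by simpa using lt_of_le_of_lt hz' hR)).1
    rw [hS', sub_zero] at h1
    have h2 : ‖(2 : ℂ) • ContinuousLinearMap.id ℂ E‖ ≤ 2 := by
      rw [norm_smul]
      simpa using mul_le_mul_of_nonneg_left ContinuousLinearMap.norm_id_le (zero_le_two (α := ℝ))
    calc ‖fderiv ℂ S z‖ = ‖(2 : ℂ) • ContinuousLinearMap.id ℂ E
          + (fderiv ℂ S z - (2 : ℂ) • ContinuousLinearMap.id ℂ E)‖ := by rw [add_sub_cancel]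
      _ ≤ 2 + C * ‖z‖ := (norm_add_le _ _).trans (add_le_add h2 h1)
      _ ≤ 2 + C * R := by gcongr

omit [NormedSpace ℂ E] in
/-- Orbits of length `n` of a map which is doubling up to second order stay under control when they
start at distance at most `δ / 2 ^ n` from the fixed point. The factor `1 + 2 ^ j / 2 ^ n` absorbs
the accumulated second order terms. -/
theorem norm_iterate_sub_le {S : E → E} (hS0 : S 0 = 0) {C ρ δ : ℝ} (hC : 0 < C)
    (hδ : 0 < δ) (hδρ : 2 * δ < ρ) (hCδ : 4 * C * δ ≤ 1)
    (hS : ∀ R < ρ, ∀ x y, ‖x‖ ≤ R → ‖y‖ ≤ R → ‖S x - S y‖ ≤ (2 + C * R) * ‖x - y‖) (n : ℕ) :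
    ∀ j ≤ n, ∀ x y, ‖x‖ ≤ δ / 2 ^ n → ‖y‖ ≤ δ / 2 ^ n →
      ‖S^[j] x - S^[j] y‖ ≤ 2 ^ j * (1 + 2 ^ j / 2 ^ n) * ‖x - y‖ := by
  intro j
  induction j with
  | zero =>
    intro _ x y _ _
    simp only [Function.iterate_zero, id_eq, pow_zero, one_mul]
    exact le_mul_of_one_le_left (norm_nonneg _) (by simp)
  | succ j ih =>
    intro hj x y hx hy
    have hfix : S^[j] 0 = 0 := Function.iterate_fixed hS0 j
    have hn0 : (0 : ℝ) < 2 ^ n := by positivity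
    set u : ℝ := 2 ^ j / 2 ^ n with hu
    have hu0 : 0 < u := by positivity
    have hu1 : u ≤ 1 := by
      rw [hu, div_le_one hn0]
      exact pow_le_pow_right₀ (by norm_num) (by omega)
    have hsize : ∀ z, ‖z‖ ≤ δ / 2 ^ n → ‖S^[j] z‖ ≤ 2 * δ * u := by
      intro z hz
      have h1 := ih (by omega) z 0 hz (by simp; positivity)
      rw [hfix, sub_zero, sub_zero] at h1
      calc ‖S^[j] z‖ ≤ 2 ^ j * (1 + u) * (δ / 2 ^ n) :=
            h1.trans (mul_le_mul_of_nonneg_left hz (by positivity))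
        _ = (1 + u) * (δ * u) := by rw [hu]; ring
        _ ≤ 2 * (δ * u) := by gcongr; linarith
        _ = 2 * δ * u := by ring
    rw [Function.iterate_succ_apply', Function.iterate_succ_apply']
    have hR : 2 * δ * u < ρ := by nlinarith
    have h2 := hS _ hR _ _ (hsize x hx) (hsize y hy)
    refine h2.trans ?_
    have h3 := ih (by omega) x y hx hy
    calc (2 + C * (2 * δ * u)) * ‖S^[j] x - S^[j] y‖
        ≤ (2 + C * (2 * δ * u)) * (2 ^ j * (1 + u) * ‖x - y‖) := by gcongr
      _ = 2 ^ j * ((2 + 2 * (C * δ) * u) * (1 + u)) * ‖x - y‖ := by ring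
      _ ≤ 2 ^ j * (2 * (1 + 2 * u)) * ‖x - y‖ := by
          refine mul_le_mul_of_nonneg_right (mul_le_mul_of_nonneg_left ?_ (by positivity))
            (norm_nonneg _)
          have h4 : C * δ ≤ 1 / 4 := by linarith
          have h5 : C * δ * (u * (1 + u)) ≤ 1 / 4 * (u * (1 + u)) := by gcongr
          nlinarith
      _ = 2 ^ (j + 1) * (1 + 2 ^ (j + 1) / 2 ^ n) * ‖x - y‖ := by rw [hu]; ring

/-- Let `S` fix the origin with derivative multiplication by `2`, and let `c` be a curve through the
origin. The `n`-th iterates of `S` at `c (t / 2 ^ n)` converge to a holomorphic function of `t`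
near the origin, and these orbits stay in any prescribed neighbourhood of the origin. -/
theorem exists_tendsto_iterate_doubling [CompleteSpace E] {S : E → E} (hS0 : S 0 = 0)
    (hS : ContDiffAt ℂ 2 S 0) (hS' : fderiv ℂ S 0 = (2 : ℂ) • ContinuousLinearMap.id ℂ E)
    {c : ℂ → E} (hc0 : c 0 = 0) (hc : ContDiffAt ℂ 2 c 0) {W : Set E} (hW : W ∈ 𝓝 0) :
    ∃ δ > 0, ∃ F : ℂ → E, DifferentiableOn ℂ F (ball 0 δ) ∧ ∀ t ∈ ball (0 : ℂ) δ,
      (∀ n, ∀ j ≤ n, S^[j] (c (t / 2 ^ n)) ∈ W) ∧ F t ∈ W ∧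
      Tendsto (fun n : ℕ ↦ S^[n] (c (t / 2 ^ n))) atTop (𝓝 (F t)) := by
  obtain ⟨C, hC, ρ, hρ, hSd, hlip⟩ := exists_lipschitz_sub_two_smul hS hS'
  obtain ⟨r, hr, hrW⟩ := Metric.mem_nhds_iff.mp hW
  -- the radius controlling the orbits in `E`
  obtain ⟨η, hη, hηρ, hCη, hηr⟩ : ∃ η > 0, 2 * η < ρ ∧ 4 * C * η ≤ 1 ∧ 2 * η < r := by
    refine ⟨min (min (ρ / 4) (1 / (4 * C))) (r / 4), by positivity, ?_, ?_, ?_⟩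
    · have := (min_le_left (min (ρ / 4) (1 / (4 * C))) (r / 4)).trans (min_le_left _ _)
      linarith
    · have := (min_le_left (min (ρ / 4) (1 / (4 * C))) (r / 4)).trans (min_le_right _ _)
      rw [le_div_iff₀ (by positivity)] at this
      linarith
    · have := min_le_right (min (ρ / 4) (1 / (4 * C))) (r / 4)
      linarith
  have hiter := norm_iterate_sub_le hS0 hC hη hηρ hCη hlip
  have hcd : DifferentiableAt ℂ c 0 := hc.differentiableAt (by norm_num)
  -- the defect `S (c (s / 2)) - c s` vanishes to second order
  obtain ⟨D, hD, hdefect⟩ : ∃ D > 0, ∀ᶠ s in 𝓝 (0 : ℂ), ‖S (c (s / 2)) - c s‖ ≤ D * ‖s‖ ^ 2 := by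
    set d : ℂ → E := fun s ↦ S (c (s / 2)) - c s with hd
    have hhalf : ContDiffAt ℂ 2 (fun s : ℂ ↦ s / 2) 0 := by fun_prop
    have hc' : ContDiffAt ℂ 2 c ((0 : ℂ) / 2) := by simpa using hc
    have hcc : ContDiffAt ℂ 2 (fun s : ℂ ↦ c (s / 2)) 0 := hc'.comp 0 hhalf
    have hS'' : ContDiffAt ℂ 2 S (c (0 / 2)) := by simpa [hc0] using hS
    have hdC : ContDiffAt ℂ 2 d 0 := (ContDiffAt.comp (0 : ℂ) hS'' hcc).sub hc
    have hd1 : HasDerivAt d 0 0 := by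
      have h1 : HasDerivAt (fun s : ℂ ↦ c (s / 2)) ((1 / 2 : ℂ) • deriv c 0) 0 := by
        have hh : HasDerivAt (fun s : ℂ ↦ s / 2) (1 / 2 : ℂ) 0 := (hasDerivAt_id 0).div_const 2
        have : HasDerivAt c (deriv c 0) ((0 : ℂ) / 2) := by simpa using hcd.hasDerivAt
        exact this.scomp 0 hh
      have h2 : HasFDerivAt S ((2 : ℂ) • ContinuousLinearMap.id ℂ E) (c (0 / 2)) := by
        rw [← hS']
        simpa [hc0] using (hS.differentiableAt (by norm_num)).hasFDerivAt
      have h3 := (h2.comp_hasDerivAt 0 h1).sub hcd.hasDerivAt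
      have h4 :
          ((2 : ℂ) • ContinuousLinearMap.id ℂ E) ((1 / 2 : ℂ) • deriv c 0) - deriv c 0 = 0 := by
        simp
      rw [h4] at h3
      exact h3
    have hdd : DifferentiableAt ℂ (deriv d) 0 := by
      have h1 : ContDiffAt ℂ 1 (fderiv ℂ d) 0 := hdC.fderiv_right (by norm_num)
      have h2 : DifferentiableAt ℂ (fderiv ℂ d) 0 := h1.differentiableAt (by norm_num)
      exact h2.clm_apply (differentiableAt_const 1)
    obtain ⟨D, hD, hb⟩ := hdd.isBigO_sub.exists_pos
    rw [Asymptotics.IsBigOWith] at hb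
    have hev := hb.and ((hdC.eventually (by simp)).mono fun x hx ↦
      hx.differentiableAt (by norm_num))
    obtain ⟨τ, hτ, hτb⟩ := Metric.eventually_nhds_iff.mp hev
    refine ⟨D, hD, ?_⟩
    filter_upwards [Metric.ball_mem_nhds (0 : ℂ) hτ] with s hs
    have key := (convex_closedBall (0 : ℂ) ‖s‖).norm_image_sub_le_of_norm_deriv_le
      (f := d) (C := D * ‖s‖) (x := 0) (y := s)
      (fun z hz ↦ (hτb (lt_of_le_of_lt (by simpa using hz) (by simpa using hs))).2)
      (fun z hz ↦ by
        have hz' : ‖z‖ ≤ ‖s‖ := by simpa using hz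
        have := (hτb (y := z) (by simpa using lt_of_le_of_lt hz' (by simpa using hs))).1
        rw [hd1.deriv, sub_zero, sub_zero] at this
        exact this.trans (by gcongr)) (by simp) (by simp)
    have hd0 : d 0 = 0 := by simp [hd, hc0, hS0]
    rw [hd0, sub_zero, sub_zero] at key
    calc ‖d s‖ ≤ _ := key
      _ = D * ‖s‖ ^ 2 := by ring
  obtain ⟨B, hB, hcB⟩ : ∃ B > 0, ∀ᶠ s in 𝓝 (0 : ℂ), ‖c s‖ ≤ B * ‖s‖ := by
    obtain ⟨B, hB, hb⟩ := hcd.isBigO_sub.exists_pos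
    rw [Asymptotics.IsBigOWith] at hb
    exact ⟨B, hB, by simpa [hc0] using hb⟩
  have hcd' : ∀ᶠ s in 𝓝 (0 : ℂ), DifferentiableAt ℂ c s :=
    (hc.eventually (by simp)).mono fun x hx ↦ hx.differentiableAt (by norm_num)
  obtain ⟨τ, hτ, hτb⟩ := Metric.eventually_nhds_iff.mp (hdefect.and (hcB.and hcd'))
  obtain ⟨δ, hδ, hδτ, hδ1, hδB⟩ : ∃ δ > 0, δ ≤ τ ∧ δ ≤ 1 ∧ (B + D) * δ ≤ η := by
    refine ⟨min (min τ 1) (η / (B + D)), by positivity, ?_, ?_, ?_⟩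
    · exact (min_le_left _ _).trans (min_le_left _ _)
    · exact (min_le_left _ _).trans (min_le_right _ _)
    · have := min_le_right (min τ 1) (η / (B + D))
      rw [le_div_iff₀ (by positivity)] at this
      linarith
  have hscale : ∀ t ∈ ball (0 : ℂ) δ, ∀ n : ℕ, ‖t / 2 ^ n‖ = ‖t‖ / 2 ^ n ∧ ‖t / 2 ^ n‖ < τ ∧
      ‖t / 2 ^ n‖ ≤ 1 := by
    intro t ht n
    have ht' : ‖t‖ < δ := by simpa using ht
    have h1 : ‖t / 2 ^ n‖ = ‖t‖ / 2 ^ n := by simp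
    have h2 : ‖t‖ / 2 ^ n ≤ ‖t‖ := div_le_self (norm_nonneg _) (one_le_pow₀ (by norm_num))
    exact ⟨h1, by rw [h1]; linarith, by rw [h1]; linarith⟩
  have hcsmall : ∀ t ∈ ball (0 : ℂ) δ, ∀ n : ℕ, ‖c (t / 2 ^ n)‖ ≤ B * δ / 2 ^ n := by
    intro t ht n
    obtain ⟨h1, h2, h3⟩ := hscale t ht n
    have ht' : ‖t‖ < δ := by simpa using ht
    refine (hτb (y := t / 2 ^ n) (by simpa using h2)).2.1.trans ?_
    rw [h1, mul_div_assoc]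
    gcongr
  have hcη : ∀ t ∈ ball (0 : ℂ) δ, ∀ n : ℕ, ‖c (t / 2 ^ n)‖ ≤ η / 2 ^ n := by
    intro t ht n
    refine (hcsmall t ht n).trans ?_
    gcongr
    nlinarith
  have horbit : ∀ t ∈ ball (0 : ℂ) δ, ∀ n, ∀ j ≤ n, ‖S^[j] (c (t / 2 ^ n))‖ ≤ 2 * η := by
    intro t ht n j hj
    have hn0 : (0 : ℝ) < 2 ^ n := by positivity
    have h1 := hiter n j hj _ 0 (hcη t ht n) (by simp; positivity)
    rw [Function.iterate_fixed hS0 j, sub_zero, sub_zero] at h1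
    have hu : (2 : ℝ) ^ j / 2 ^ n ≤ 1 := by
      rw [div_le_one hn0]; exact pow_le_pow_right₀ (by norm_num) hj
    calc ‖S^[j] (c (t / 2 ^ n))‖ ≤ 2 ^ j * (1 + 2 ^ j / 2 ^ n) * (η / 2 ^ n) :=
          h1.trans (mul_le_mul_of_nonneg_left (hcη t ht n) (by positivity))
      _ = (2 ^ j / 2 ^ n) * (1 + 2 ^ j / 2 ^ n) * η := by ring
      _ ≤ 1 * (1 + 1) * η := by gcongr
      _ = 2 * η := by ring
  have hstep : ∀ t ∈ ball (0 : ℂ) δ, ∀ n : ℕ,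
      dist (S^[n] (c (t / 2 ^ n))) (S^[n + 1] (c (t / 2 ^ (n + 1)))) ≤ 4 * D / 2 / 2 ^ n := by
    intro t ht n
    obtain ⟨h1, h2, h3⟩ := hscale t ht n
    have ht' : ‖t‖ < δ := by simpa using ht
    have hhalf : t / 2 ^ (n + 1) = t / 2 ^ n / 2 := by rw [pow_succ, div_div]
    have hdef := (hτb (y := t / 2 ^ n) (by simpa using h2)).1
    rw [← hhalf, h1] at hdef
    have hsq : D * (‖t‖ / 2 ^ n) ^ 2 ≤ D * (δ / 2 ^ n) * (1 / 2 ^ n) := by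
      have : ‖t‖ / 2 ^ n ≤ 1 / 2 ^ n := by gcongr; linarith
      calc D * (‖t‖ / 2 ^ n) ^ 2 = D * ((‖t‖ / 2 ^ n) * (‖t‖ / 2 ^ n)) := by ring
        _ ≤ D * ((δ / 2 ^ n) * (1 / 2 ^ n)) := by gcongr
        _ = _ := by ring
    have hone : (1 : ℝ) / 2 ^ n ≤ 1 := by
      rw [div_le_one (by positivity)]; exact one_le_pow₀ (by norm_num)
    have hSc : ‖S (c (t / 2 ^ (n + 1)))‖ ≤ η / 2 ^ n := by
      calc ‖S (c (t / 2 ^ (n + 1)))‖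
          = ‖c (t / 2 ^ n) + (S (c (t / 2 ^ (n + 1))) - c (t / 2 ^ n))‖ := by rw [add_sub_cancel]
        _ ≤ B * δ / 2 ^ n + D * (δ / 2 ^ n) * (1 / 2 ^ n) :=
            (norm_add_le _ _).trans (add_le_add (hcsmall t ht n) (hdef.trans hsq))
        _ ≤ B * δ / 2 ^ n + D * (δ / 2 ^ n) * 1 := by gcongr
        _ = (B + D) * δ / 2 ^ n := by ring
        _ ≤ η / 2 ^ n := by gcongr
    rw [Function.iterate_succ_apply, dist_comm, dist_eq_norm]
    have h4 := hiter n n le_rfl _ _ hSc (hcη t ht n)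
    have hn0 : (2 : ℝ) ^ n ≠ 0 := by positivity
    calc _ ≤ _ := h4
      _ ≤ 2 ^ n * (1 + 2 ^ n / 2 ^ n) * (D * (δ / 2 ^ n) * (1 / 2 ^ n)) := by
          gcongr; exact hdef.trans hsq
      _ = 2 * D * δ / 2 ^ n := by field_simp; ring
      _ ≤ 2 * D * 1 / 2 ^ n := by gcongr
      _ = 4 * D / 2 / 2 ^ n := by ring
  have hlim : ∀ t ∈ ball (0 : ℂ) δ, ∃ L, Tendsto (fun n : ℕ ↦ S^[n] (c (t / 2 ^ n))) atTop (𝓝 L) :=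
    fun t ht ↦ cauchySeq_tendsto_of_complete (cauchySeq_of_le_geometric_two (hstep t ht))
  choose! F hF using hlim
  have hdiffn : ∀ n, DifferentiableOn ℂ (fun t ↦ S^[n] (c (t / 2 ^ n))) (ball 0 δ) := by
    intro n t ht
    apply DifferentiableAt.differentiableWithinAt
    have key : ∀ j ≤ n, DifferentiableAt ℂ (fun t ↦ S^[j] (c (t / 2 ^ n))) t := by
      intro j
      induction j with
      | zero =>
        intro _
        have h1 : DifferentiableAt ℂ (fun t : ℂ ↦ t / 2 ^ n) t := by fun_prop
        exact DifferentiableAt.comp t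
          (hτb (y := t / 2 ^ n) (by simpa using (hscale t ht n).2.1)).2.2 h1
      | succ j ih =>
        intro hj
        simp only [Function.iterate_succ_apply']
        exact DifferentiableAt.comp t
          (hSd _ ((horbit t ht n j (by omega)).trans_lt hηρ)) (ih (by omega))
    exact key n le_rfl
  have hunif : TendstoUniformlyOn (fun (n : ℕ) t ↦ S^[n] (c (t / 2 ^ n))) F atTop (ball 0 δ) := by
    rw [Metric.tendstoUniformlyOn_iff]
    intro ε hε
    have h0 : Tendsto (fun n : ℕ ↦ 4 * D / 2 ^ n) atTop (𝓝 0) :=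
      tendsto_const_nhds.div_atTop (tendsto_pow_atTop_atTop_of_one_lt (by norm_num))
    filter_upwards [h0.eventually_lt_const hε] with n hn t ht
    rw [dist_comm]
    exact (dist_le_of_le_geometric_two_of_tendsto (hstep t ht) (hF t ht) n).trans_lt hn
  refine ⟨δ, hδ, F, hunif.tendstoLocallyUniformlyOn.differentiableOn
    (Eventually.of_forall hdiffn) isOpen_ball, fun t ht ↦ ⟨fun n j hj ↦ ?_, ?_, hF t ht⟩⟩
  · exact hrW (by simpa using (horbit t ht n j hj).trans_lt hηr)
  · have : ‖F t‖ ≤ 2 * η :=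
      le_of_tendsto (hF t ht).norm (Eventually.of_forall fun n ↦ horbit t ht n n le_rfl)
    exact hrW (by simpa using this.trans_lt hηr)

end Doubling

end ComplexNil

namespace ComplexNil

/-! ### Closed analytic one-forms -/

section Forms

open Filter Topology

variable {E : Type*} [NormedAddCommGroup E] [NormedSpace ℂ E]
  {F : Type*} [NormedAddCommGroup F] [NormedSpace ℂ F] [CompleteSpace F]

/-- Termwise integration of a power series of linear maps along a ray. -/
theorem hasSum_integral_ray {θ : E → E →L[ℂ] F} {p : FormalMultilinearSeries ℂ E (E →L[ℂ] F)}
    {r : ENNReal} (hp : HasFPowerSeriesOnBall θ p 0 r) {y : E} (hy : y ∈ Metric.eball (0 : E) r)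
    (hray : ∀ t ∈ Set.uIcc (0 : ℝ) 1, (t : ℂ) • y ∈ Metric.eball (0 : E) r) :
    HasSum (fun n : ℕ ↦ ((n : ℂ) + 1)⁻¹ • p n (fun _ ↦ y) y)
      (∫ t in (0 : ℝ)..1, θ ((t : ℂ) • y) y) := by
  have hylt : (‖y‖₊ : ENNReal) < p.radius := by
    refine lt_of_lt_of_le ?_ hp.r_le
    exact (by simpa using hy : ‖y‖ₑ < r)
  have hsummable : Summable fun n ↦ ‖p n‖ * ‖y‖ ^ n * ‖y‖ :=
    (p.summable_norm_mul_pow hylt).mul_right _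
  have hseries := intervalIntegral.hasSum_integral_of_dominated_convergence (a := 0) (b := 1)
    (μ := MeasureTheory.volume)
    (F := fun n (t : ℝ) ↦ (t : ℂ) ^ n • p n (fun _ ↦ y) y) (f := fun t : ℝ ↦ θ ((t : ℂ) • y) y)
    (fun n _ ↦ ‖p n‖ * ‖y‖ ^ n * ‖y‖)
    (fun n ↦ by
      refine Continuous.aestronglyMeasurable ?_
      fun_prop)
    (fun n ↦ Eventually.of_forall fun t ht ↦ by
      rw [Set.uIoc_of_le zero_le_one] at ht
      rw [norm_smul, norm_pow, Complex.norm_real, Real.norm_eq_abs, abs_of_nonneg ht.1.le]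
      refine (mul_le_of_le_one_left (norm_nonneg _) (pow_le_one₀ ht.1.le ht.2)).trans ?_
      refine (ContinuousLinearMap.le_opNorm _ _).trans ?_
      gcongr
      simpa using (p n).le_opNorm (fun _ ↦ y))
    (Eventually.of_forall fun t _ ↦ hsummable)
    intervalIntegrable_const
    (Eventually.of_forall fun t ht ↦ by
      have h1 := hp.hasSum (hray t (Set.uIoc_subset_uIcc ht))
      rw [zero_add] at h1
      have h2 := (ContinuousLinearMap.apply ℂ F y).hasSum h1
      refine h2.congr_fun fun n ↦ ?_
      have h3 : p n (fun _ ↦ (t : ℂ) • y) = (t : ℂ) ^ n • p n (fun _ ↦ y) := by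
        simpa using (p n).map_smul_univ (fun _ ↦ (t : ℂ)) (fun _ ↦ y)
      rw [h3]
      rfl)
  have hint : ∀ n : ℕ, ∫ t in (0 : ℝ)..1, (t : ℂ) ^ n • p n (fun _ ↦ y) y
      = ((n : ℂ) + 1)⁻¹ • p n (fun _ ↦ y) y := by
    intro n
    rw [intervalIntegral.integral_smul_const]
    congr 1
    have h1 : (fun t : ℝ ↦ (t : ℂ) ^ n) = fun t : ℝ ↦ ((t ^ n : ℝ) : ℂ) := by ext; simp
    rw [h1, intervalIntegral.integral_ofReal, integral_pow]
    simp
  simpa only [hint] using hseries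

/-- A function with analytic derivative is analytic: integrate the power series of the derivative
along the rays. -/
theorem analyticAt_of_hasFDerivAt {h : E → F} {θ : E → E →L[ℂ] F}
    (hθ : AnalyticAt ℂ θ 0) (hh : ∀ᶠ y in 𝓝 0, HasFDerivAt h (θ y) y) : AnalyticAt ℂ h 0 := by
  obtain ⟨p, r₀, hp₀⟩ := hθ
  obtain ⟨ε, hε, hball⟩ := EMetric.mem_nhds_iff.mp hh
  set r := min r₀ ε with hr
  have hp : HasFPowerSeriesOnBall θ p 0 r := hp₀.mono (lt_min hp₀.r_pos hε) (min_le_left _ _)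
  set p' : FormalMultilinearSeries ℂ E (E →L[ℂ] F) := fun n ↦ ((n : ℂ) + 1)⁻¹ • p n with hp'
  have hcoef : ∀ n : ℕ, ‖((n : ℂ) + 1)⁻¹‖ ≤ 1 := by
    intro n
    rw [norm_inv, ← Nat.cast_succ, Complex.norm_natCast]
    exact inv_le_one_of_one_le₀ (by exact_mod_cast Nat.succ_pos n)
  have hrad : p.radius ≤ p'.radius := by
    refine ENNReal.le_of_forall_nnreal_lt fun s hs ↦ ?_
    obtain ⟨C, -, hC⟩ := p.norm_mul_pow_le_of_lt_radius hs
    refine p'.le_radius_of_bound C fun n ↦ le_trans ?_ (hC n)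
    gcongr
    simp only [hp', norm_smul]
    exact mul_le_of_le_one_left (norm_nonneg _) (hcoef n)
  refine ⟨p'.unshift (h 0), r, ?_, hp.r_pos, ?_⟩
  · rw [FormalMultilinearSeries.radius_unshift]
    exact hp.r_le.trans hrad
  intro y hy
  have hray : ∀ t ∈ Set.uIcc (0 : ℝ) 1, (t : ℂ) • y ∈ Metric.eball (0 : E) r := by
    intro t ht
    rw [Set.uIcc_of_le zero_le_one] at ht
    simp only [Metric.mem_eball, edist_zero_right] at hy ⊢
    refine lt_of_le_of_lt ?_ hy
    rw [enorm_le_iff_norm_le, norm_smul, Complex.norm_real, Real.norm_eq_abs, abs_of_nonneg ht.1]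
    exact mul_le_of_le_one_left (norm_nonneg _) ht.2
  have hderiv : ∀ t ∈ Set.uIcc (0 : ℝ) 1,
      HasDerivAt (fun t : ℝ ↦ h ((t : ℂ) • y)) (θ ((t : ℂ) • y) y) t := by
    intro t ht
    have h1 : HasFDerivAt h (θ ((t : ℂ) • y)) ((t : ℂ) • y) :=
      hball (Metric.eball_subset_eball (min_le_right _ _) (hray t ht))
    have h2 : HasDerivAt (fun t : ℂ ↦ t • y) y (t : ℂ) := by
      simpa using (hasDerivAt_id (t : ℂ)).smul_const y
    have h3 : HasDerivAt (fun t : ℂ ↦ h (t • y)) (θ ((t : ℂ) • y) y) (t : ℂ) :=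
      h1.comp_hasDerivAt (t : ℂ) h2
    have h4 : HasDerivAt (fun t : ℝ ↦ (t : ℂ)) 1 t := Complex.ofRealCLM.hasDerivAt
    have h5 := HasDerivAt.scomp t h3 h4
    rw [one_smul] at h5
    exact h5
  have hcont : ContinuousOn (fun t : ℝ ↦ θ ((t : ℂ) • y) y) (Set.uIcc (0 : ℝ) 1) := by
    refine ContinuousOn.clm_apply ?_ continuousOn_const
    exact hp.continuousOn.comp (by fun_prop) hray
  have hftc := intervalIntegral.integral_eq_sub_of_hasDerivAt hderiv hcont.intervalIntegrable
  have hseries := hasSum_integral_ray hp hy hray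
  rw [hftc] at hseries
  simp only [Complex.ofReal_one, one_smul, Complex.ofReal_zero, zero_smul] at hseries
  have hshift : HasSum (fun n ↦ (p'.unshift (h 0)) (n + 1) fun _ ↦ y) (h y - h 0) := by
    refine hseries.congr_fun fun n ↦ ?_
    simp only [FormalMultilinearSeries.unshift, Nat.succ_eq_add_one,
      continuousMultilinearCurryRightEquiv_symm_apply']
    rfl
  rw [zero_add]
  have h0 : (p'.unshift (h 0) 0) (fun _ ↦ y) = h 0 := rfl
  have h1 := HasSum.zero_add (f := fun n ↦ (p'.unshift (h 0)) n fun _ ↦ y) hshift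
  rwa [h0, add_sub_cancel] at h1

omit [CompleteSpace F] in
/-- The exterior derivative, that is the antisymmetrized derivative of a one-form, commutes with
pullbacks. -/
theorem fderiv_antisymm_of_pullback {θ : E → E →L[ℂ] F} {α : E → E} {x : E} {c : ℂ}
    (hθ : DifferentiableAt ℂ θ x) (hθ' : DifferentiableAt ℂ θ (α x)) (hα : ContDiffAt ℂ ω α x)
    (h : ∀ᶠ y in 𝓝 x, c • θ y = (θ (α y)).comp (fderiv ℂ α y)) (u v : E) :
    c • (fderiv ℂ θ x u v - fderiv ℂ θ x v u)
      = fderiv ℂ θ (α x) (fderiv ℂ α x u) (fderiv ℂ α x v)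
        - fderiv ℂ θ (α x) (fderiv ℂ α x v) (fderiv ℂ α x u) := by
  have hdα : HasFDerivAt α (fderiv ℂ α x) x := (hα.differentiableAt (by simp)).hasFDerivAt
  have hd2α : HasFDerivAt (fderiv ℂ α) (fderiv ℂ (fderiv ℂ α) x) x :=
    ((hα.fderiv_right (m := 1) (by simp)).differentiableAt (by simp)).hasFDerivAt
  have h1 := (HasFDerivAt.comp x hθ'.hasFDerivAt hdα).clm_comp hd2α
  have h2 := (hθ.hasFDerivAt.const_smul c).congr_of_eventuallyEq (h.mono fun _ h ↦ h.symm)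
  have h3 : ∀ u v, c • fderiv ℂ θ x u v = θ (α x) (fderiv ℂ (fderiv ℂ α) x u v)
      + fderiv ℂ θ (α x) (fderiv ℂ α x u) (fderiv ℂ α x v) := by
    intro u v
    have := congrArg (fun L ↦ L u v) (h2.unique h1)
    simpa using this
  have hsymm := (ContDiffAt.isSymmSndFDerivAt_of_omega hα).eq u v
  rw [smul_sub, h3, h3, hsymm]
  abel

end Forms

end ComplexNil

namespace ComplexNil

/-! ### Coordinates at the identity of a complex Lie group -/

section Coordinates

open Filter Topology

variable (E : Type*) [NormedAddCommGroup E]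
  {G : Type*} [TopologicalSpace G] [ChartedSpace E G] [Group G]

/-- The chart of `G` at the identity, translated so that the identity has coordinate `0`. It is
meaningful near the identity only. -/
noncomputable def coord (g : G) : E := chartAt E (1 : G) g - chartAt E (1 : G) 1

variable {E} (G)

/-- The local inverse of `coord`, meaningful near `0` only. -/
noncomputable def coordSymm (v : E) : G := (chartAt E (1 : G)).symm (v + chartAt E (1 : G) 1)

variable {G}

@[simp] theorem coord_one : coord E (1 : G) = 0 := sub_self _

@[simp] theorem coordSymm_zero : coordSymm G (0 : E) = 1 := by
  simp [coordSymm]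

variable (G) in
theorem eventually_coord_coordSymm : ∀ᶠ v in 𝓝 (0 : E), coord E (coordSymm G v) = v := by
  have h1 : Tendsto (fun v : E ↦ v + chartAt E (1 : G) 1) (𝓝 0) (𝓝 (chartAt E (1 : G) 1)) := by
    have : ContinuousAt (fun v : E ↦ v + chartAt E (1 : G) 1) 0 := by fun_prop
    simpa [ContinuousAt] using this
  filter_upwards [h1.eventually ((chartAt E (1 : G)).open_target.mem_nhds
    (mem_chart_target E (1 : G)))] with v hv
  simp [coord, coordSymm, (chartAt E (1 : G)).right_inv hv]

variable (E) in
theorem eventually_coordSymm_coord : ∀ᶠ g in 𝓝 (1 : G), coordSymm G (coord E g) = g := by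
  filter_upwards [(chartAt E (1 : G)).open_source.mem_nhds (mem_chart_source E (1 : G))] with g hg
  simp [coord, coordSymm, (chartAt E (1 : G)).left_inv hg]

variable [NormedSpace ℂ E]

variable (E) in
theorem t2Space_of_lieGroup [LieGroup 𝓘(ℂ, E) ω G] : T2Space G := by
  have : IsTopologicalGroup G := topologicalGroup_of_lieGroup 𝓘(ℂ, E) ω
  have : T1Space G := ChartedSpace.t1Space E G
  infer_instance

variable [LieGroup 𝓘(ℂ, E) ω G]

variable (E) in
theorem contMDiffAt_coord : ContMDiffAt 𝓘(ℂ, E) 𝓘(ℂ, E) ω (coord E : G → E) 1 := by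
  have h : ContMDiffAt 𝓘(ℂ, E) 𝓘(ℂ, E) ω (chartAt E (1 : G)) 1 :=
    (contMDiffOn_chart (I := 𝓘(ℂ, E)) (n := ω)).contMDiffAt
      ((chartAt E (1 : G)).open_source.mem_nhds (mem_chart_source E (1 : G)))
  exact h.sub contMDiffAt_const

variable (G) in
theorem contMDiffAt_coordSymm : ContMDiffAt 𝓘(ℂ, E) 𝓘(ℂ, E) ω (coordSymm G : E → G) 0 := by
  have h : ContMDiffAt 𝓘(ℂ, E) 𝓘(ℂ, E) ω (chartAt E (1 : G)).symm
      ((0 : E) + chartAt E (1 : G) 1) := by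
    rw [zero_add]
    exact (contMDiffOn_chart_symm (I := 𝓘(ℂ, E)) (n := ω)).contMDiffAt
      ((chartAt E (1 : G)).open_target.mem_nhds (mem_chart_target E (1 : G)))
  exact ContMDiffAt.comp (0 : E) h (contMDiffAt_id.add contMDiffAt_const)

section Calculus

variable {X : Type*} [NormedAddCommGroup X] [NormedSpace ℂ X]
  {Y : Type*} [NormedAddCommGroup Y] [NormedSpace ℂ Y]

theorem contDiffAt_coord_comp {a : X → G} {x : X}
    (ha : ContMDiffAt 𝓘(ℂ, X) 𝓘(ℂ, E) ω a x) (hax : a x = 1) :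
    ContDiffAt ℂ ω (fun y ↦ coord E (a y)) x := by
  rw [← contMDiffAt_iff_contDiffAt]
  exact ContMDiffAt.comp_of_eq (contMDiffAt_coord E) ha hax

theorem contDiffAt_comp_coordSymm {Φ : G → Y}
    (hΦ : ContMDiffAt 𝓘(ℂ, E) 𝓘(ℂ, Y) ω Φ 1) :
    ContDiffAt ℂ ω (fun v : E ↦ Φ (coordSymm G v)) 0 := by
  rw [← contMDiffAt_iff_contDiffAt]
  exact ContMDiffAt.comp_of_eq hΦ (contMDiffAt_coordSymm G) coordSymm_zero

/-- The chain rule at the identity, in coordinates. -/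
theorem hasFDerivAt_comp_of_eq_one {Φ : G → Y} (hΦ : ContMDiffAt 𝓘(ℂ, E) 𝓘(ℂ, Y) ω Φ 1)
    {a : X → G} {x : X} {A : X →L[ℂ] E} (hax : a x = 1) (hac : ContinuousAt a x)
    (hA : HasFDerivAt (fun y ↦ coord E (a y)) A x) :
    HasFDerivAt (fun y ↦ Φ (a y)) ((fderiv ℂ (fun v : E ↦ Φ (coordSymm G v)) 0).comp A) x := by
  have h1 : HasFDerivAt (fun v : E ↦ Φ (coordSymm G v))
      (fderiv ℂ (fun v : E ↦ Φ (coordSymm G v)) 0) (coord E (a x)) := by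
    rw [hax, coord_one]
    exact ((contDiffAt_comp_coordSymm hΦ).differentiableAt (by simp)).hasFDerivAt
  refine (HasFDerivAt.comp x h1 hA).congr_of_eventuallyEq ?_
  have h2 : Tendsto a (𝓝 x) (𝓝 1) := hax ▸ hac.tendsto
  filter_upwards [h2.eventually (eventually_coordSymm_coord E)] with y hy
  simp [hy]

/-- The derivative of the multiplication at the identity is the addition. -/
theorem hasFDerivAt_coord_mul {a b : X → G} {x : X} {A B : X →L[ℂ] E} (hax : a x = 1)
    (hbx : b x = 1) (hac : ContinuousAt a x) (hbc : ContinuousAt b x)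
    (hA : HasFDerivAt (fun y ↦ coord E (a y)) A x)
    (hB : HasFDerivAt (fun y ↦ coord E (b y)) B x) :
    HasFDerivAt (fun y ↦ coord E (a y * b y)) (A + B) x := by
  set M : E × E → E := fun p ↦ coord E (coordSymm G p.1 * coordSymm G p.2) with hM
  have hMd : DifferentiableAt ℂ M (0, 0) := by
    have h1 : ContMDiffAt 𝓘(ℂ, E × E) 𝓘(ℂ, E) ω
        (fun p : E × E ↦ coordSymm G p.1 * coordSymm G p.2) (0, 0) := by
      refine ContMDiffAt.mul ?_ ?_
      · exact ContMDiffAt.comp (0, 0) (f := Prod.fst) (contMDiffAt_coordSymm G)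
          contDiff_fst.contMDiff.contMDiffAt
      · exact ContMDiffAt.comp (0, 0) (f := Prod.snd) (contMDiffAt_coordSymm G)
          contDiff_snd.contMDiff.contMDiffAt
    exact (contDiffAt_coord_comp h1 (by simp)).differentiableAt (by simp)
  have hl : (fderiv ℂ M (0, 0)).comp (ContinuousLinearMap.inl ℂ E E)
      = ContinuousLinearMap.id ℂ E := by
    have h1 : HasFDerivAt (fun v : E ↦ M (v, 0))
        ((fderiv ℂ M (0, 0)).comp (ContinuousLinearMap.inl ℂ E E)) 0 :=
      HasFDerivAt.comp (0 : E) (f := fun v : E ↦ (v, (0 : E))) hMd.hasFDerivAt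
        (ContinuousLinearMap.inl ℂ E E).hasFDerivAt
    refine h1.unique ((hasFDerivAt_id (0 : E)).congr_of_eventuallyEq ?_)
    filter_upwards [eventually_coord_coordSymm G] with v hv
    simpa [hM] using hv
  have hr : (fderiv ℂ M (0, 0)).comp (ContinuousLinearMap.inr ℂ E E)
      = ContinuousLinearMap.id ℂ E := by
    have h1 : HasFDerivAt (fun v : E ↦ M (0, v))
        ((fderiv ℂ M (0, 0)).comp (ContinuousLinearMap.inr ℂ E E)) 0 :=
      HasFDerivAt.comp (0 : E) (f := fun v : E ↦ ((0 : E), v)) hMd.hasFDerivAt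
        (ContinuousLinearMap.inr ℂ E E).hasFDerivAt
    refine h1.unique ((hasFDerivAt_id (0 : E)).congr_of_eventuallyEq ?_)
    filter_upwards [eventually_coord_coordSymm G] with v hv
    simpa [hM] using hv
  have h1 : HasFDerivAt M (fderiv ℂ M (0, 0)) (coord E (a x), coord E (b x)) := by
    rw [hax, hbx, coord_one]
    exact hMd.hasFDerivAt
  have h2 := HasFDerivAt.comp x (f := fun y ↦ (coord E (a y), coord E (b y))) h1 (hA.prodMk hB)
  have h3 : (fderiv ℂ M (0, 0)).comp (A.prod B) = A + B := by
    ext v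
    have h4 := congrArg (fun L ↦ L (A v)) hl
    have h5 := congrArg (fun L ↦ L (B v)) hr
    simp only [ContinuousLinearMap.comp_apply, ContinuousLinearMap.inl_apply,
      ContinuousLinearMap.inr_apply, ContinuousLinearMap.id_apply] at h4 h5
    have h6 : (A v, B v) = (A v, (0 : E)) + ((0 : E), B v) := by simp
    rw [ContinuousLinearMap.comp_apply, ContinuousLinearMap.prod_apply, h6, map_add, h4, h5]
    rfl
  rw [h3] at h2
  refine h2.congr_of_eventuallyEq ?_
  have h4 : Tendsto a (𝓝 x) (𝓝 1) := hax ▸ hac.tendsto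
  have h5 : Tendsto b (𝓝 x) (𝓝 1) := hbx ▸ hbc.tendsto
  filter_upwards [h4.eventually (eventually_coordSymm_coord E),
    h5.eventually (eventually_coordSymm_coord E)] with y hy hy'
  simp [hM, hy, hy']

/-- The derivative of the inversion at the identity is the negation. -/
theorem hasFDerivAt_coord_inv {a : X → G} {x : X} (hax : a x = 1)
    (ha : ContMDiffAt 𝓘(ℂ, X) 𝓘(ℂ, E) ω a x) :
    HasFDerivAt (fun y ↦ coord E (a y)⁻¹) (-fderiv ℂ (fun y ↦ coord E (a y)) x) x := by
  have hax' : (a x)⁻¹ = 1 := by simp [hax]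
  have ha' : ContMDiffAt 𝓘(ℂ, X) 𝓘(ℂ, E) ω (fun y ↦ (a y)⁻¹) x := ha.inv
  have h1 := ((contDiffAt_coord_comp ha hax).differentiableAt (by simp)).hasFDerivAt
  have h2 := ((contDiffAt_coord_comp ha' hax').differentiableAt (by simp)).hasFDerivAt
  have h3 := hasFDerivAt_coord_mul hax hax' ha.continuousAt ha'.continuousAt h1 h2
  simp only [mul_inv_cancel, coord_one] at h3
  have h4 := h3.unique (hasFDerivAt_const (0 : E) x)
  rw [← eq_neg_of_add_eq_zero_right h4]
  exact h2

end Calculus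

/-- The construction of one-parameter subgroups: for a holomorphic curve `c` in `G` through the
identity, `c (t / 2 ^ n) ^ (2 ^ n)` converges for all `t`, and the limit is holomorphic in `t`. -/
theorem exists_tendsto_pow_two_pow [CompleteSpace E] {c : ℂ → G} (hc0 : c 0 = 1)
    (hc : ContMDiffAt 𝓘(ℂ, ℂ) 𝓘(ℂ, E) ω c 0) :
    ∃ σ : ℂ → G, ContMDiff 𝓘(ℂ, ℂ) 𝓘(ℂ, E) ω σ ∧
      ∀ t, Tendsto (fun n : ℕ ↦ c (t / 2 ^ n) ^ (2 ^ n)) atTop (𝓝 (σ t)) := by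
  have : IsTopologicalGroup G := topologicalGroup_of_lieGroup 𝓘(ℂ, E) ω
  have : T2Space G := t2Space_of_lieGroup E
  set S : E → E := fun v ↦ coord E (coordSymm G v * coordSymm G v) with hS
  have hψψ : ContMDiffAt 𝓘(ℂ, E) 𝓘(ℂ, E) ω (fun v : E ↦ coordSymm G v * coordSymm G v) 0 :=
    (contMDiffAt_coordSymm G).mul (contMDiffAt_coordSymm G)
  have hSC : ContDiffAt ℂ ω S 0 := contDiffAt_coord_comp hψψ (by simp)
  have hS0 : S 0 = 0 := by simp [hS]
  have hψid : HasFDerivAt (fun v : E ↦ coord E (coordSymm G v)) (ContinuousLinearMap.id ℂ E) 0 :=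
    (hasFDerivAt_id (0 : E)).congr_of_eventuallyEq (eventually_coord_coordSymm G)
  have hψc : ContinuousAt (coordSymm G : E → G) 0 := (contMDiffAt_coordSymm G).continuousAt
  have hS' : fderiv ℂ S 0 = (2 : ℂ) • ContinuousLinearMap.id ℂ E := by
    rw [two_smul]
    exact (hasFDerivAt_coord_mul coordSymm_zero coordSymm_zero hψc hψc hψid hψid).fderiv
  set W : Set E := {v | coordSymm G (S v) = coordSymm G v * coordSymm G v ∧
    ContMDiffAt 𝓘(ℂ, E) 𝓘(ℂ, E) ω (coordSymm G : E → G) v} with hW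
  have hWmem : W ∈ 𝓝 (0 : E) := by
    have h1 : Tendsto (fun v : E ↦ coordSymm G v * coordSymm G v) (𝓝 0) (𝓝 1) := by
      have := hψψ.continuousAt.tendsto
      simpa using this
    exact (h1.eventually (eventually_coordSymm_coord E)).and
      ((contMDiffAt_iff_contMDiffAt_nhds (by simp)).mp (contMDiffAt_coordSymm G))
  have hcC : ContDiffAt ℂ ω (fun t ↦ coord E (c t)) 0 := contDiffAt_coord_comp hc hc0
  obtain ⟨δ₀, hδ₀, F, hF, horb⟩ := exists_tendsto_iterate_doubling hS0 (hSC.of_le le_top) hS'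
    (c := fun t ↦ coord E (c t)) (by simp [hc0]) (hcC.of_le le_top) hWmem
  obtain ⟨δ₁, hδ₁, hcψ⟩ : ∃ δ₁ > 0, ∀ t ∈ Metric.ball (0 : ℂ) δ₁,
      coordSymm G (coord E (c t)) = c t := by
    have h1 : Tendsto c (𝓝 0) (𝓝 1) := hc0 ▸ hc.continuousAt.tendsto
    exact Metric.mem_nhds_iff.mp (h1.eventually (eventually_coordSymm_coord E))
  set δ := min δ₀ δ₁ with hδ
  have hδpos : 0 < δ := lt_min hδ₀ hδ₁
  have hlocal : ∀ t ∈ Metric.ball (0 : ℂ) δ,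
      Tendsto (fun n : ℕ ↦ c (t / 2 ^ n) ^ (2 ^ n)) atTop (𝓝 (coordSymm G (F t))) := by
    intro t ht
    obtain ⟨h1, h2, h3⟩ := horb t (Metric.ball_subset_ball (min_le_left _ _) ht)
    have h4 := (h2.2.continuousAt.tendsto).comp h3
    refine h4.congr fun n ↦ ?_
    have key : ∀ j ≤ n,
        coordSymm G (S^[j] (coord E (c (t / 2 ^ n)))) = c (t / 2 ^ n) ^ (2 ^ j) := by
      intro j
      induction j with
      | zero =>
        intro _
        have ht' : t / 2 ^ n ∈ Metric.ball (0 : ℂ) δ₁ := by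
          have h5 : ‖t‖ < δ₁ := by
            have := Metric.ball_subset_ball (min_le_right δ₀ δ₁) ht
            simpa using this
          have h6 : ‖t‖ / 2 ^ n ≤ ‖t‖ := div_le_self (norm_nonneg _) (one_le_pow₀ (by norm_num))
          simpa using h6.trans_lt h5
        simpa using hcψ _ ht'
      | succ j ih =>
        intro hj
        rw [Function.iterate_succ_apply', (h1 n j (by omega)).1, ih (by omega), ← pow_add]
        congr 1
        ring
    exact key n le_rfl
  have hscale : ∀ t : ℂ, ∃ m : ℕ, t / 2 ^ m ∈ Metric.ball (0 : ℂ) δ := by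
    intro t
    have h1 : Tendsto (fun m : ℕ ↦ ‖t‖ / 2 ^ m) atTop (𝓝 0) :=
      tendsto_const_nhds.div_atTop (tendsto_pow_atTop_atTop_of_one_lt (by norm_num))
    obtain ⟨m, hm⟩ := (h1.eventually_lt_const hδpos).exists
    exact ⟨m, by simpa using hm⟩
  have hglobal : ∀ (m : ℕ) (t : ℂ), t / 2 ^ m ∈ Metric.ball (0 : ℂ) δ →
      Tendsto (fun n : ℕ ↦ c (t / 2 ^ n) ^ (2 ^ n)) atTop
        (𝓝 (coordSymm G (F (t / 2 ^ m)) ^ (2 ^ m))) := by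
    intro m t ht
    rw [← tendsto_add_atTop_iff_nat m]
    refine ((hlocal _ ht).pow (2 ^ m)).congr fun n ↦ ?_
    rw [← pow_mul, ← pow_add, div_div, ← pow_add, add_comm m n]
  choose σ hσ using fun t ↦ (hscale t).elim fun m hm ↦ (⟨_, hglobal m t hm⟩ : ∃ g, Tendsto
    (fun n : ℕ ↦ c (t / 2 ^ n) ^ (2 ^ n)) atTop (𝓝 g))
  refine ⟨σ, fun t ↦ ?_, hσ⟩
  obtain ⟨m, hm⟩ := hscale t
  have hFt : ContMDiffAt 𝓘(ℂ, ℂ) 𝓘(ℂ, E) ω F (t / 2 ^ m) := by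
    rw [contMDiffAt_iff_contDiffAt]
    exact ((hF.mono (Metric.ball_subset_ball (min_le_left _ _))).analyticAt
      (Metric.isOpen_ball.mem_nhds hm)).contDiffAt
  have hdiv : ContMDiffAt 𝓘(ℂ, ℂ) 𝓘(ℂ, ℂ) ω (fun s : ℂ ↦ s / 2 ^ m) t := by
    rw [contMDiffAt_iff_contDiffAt]; fun_prop
  have h1 : ContMDiffAt 𝓘(ℂ, ℂ) 𝓘(ℂ, E) ω (fun s ↦ coordSymm G (F (s / 2 ^ m)) ^ (2 ^ m)) t := by
    have h2 := (horb _ (Metric.ball_subset_ball (min_le_left _ _) hm)).2.1.2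
    have h3 := ContMDiffAt.comp t (f := fun s ↦ F (s / 2 ^ m)) h2 (ContMDiffAt.comp t hFt hdiv)
    exact ((contMDiff_pow (I := 𝓘(ℂ, E)) (n := ω) (G := G) (2 ^ m)).contMDiffAt).comp t h3
  refine h1.congr_of_eventuallyEq ?_
  have h3 : ContinuousAt (fun s : ℂ ↦ s / 2 ^ m) t := by fun_prop
  filter_upwards [h3.eventually (Metric.isOpen_ball.mem_nhds hm)] with s hs
  exact tendsto_nhds_unique (hσ s) (hglobal m s hs)

end Coordinates

end ComplexNil

namespace ComplexNil

/-! ### Holomorphic retracts and invariant functionals -/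

section Retracts

open Filter Topology

variable (E : Type*) [NormedAddCommGroup E] [NormedSpace ℂ E]
  {G : Type*} [TopologicalSpace G] [ChartedSpace E G] [Group G]

/-- The subgroup `K` is a holomorphic retract of `G`, with retraction `r`. Such subgroups play the
role of closed connected complex Lie subgroups: tangent vectors, forms and functions on `K` are
handled through their pullbacks to `G` under `r`. -/
structure IsHolomorphicRetract (K : Subgroup G) (r : G → G) : Prop where
  contMDiff : ContMDiff 𝓘(ℂ, E) 𝓘(ℂ, E) ω r
  mem : ∀ g, r g ∈ K
  apply_of_mem : ∀ k ∈ K, r k = k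

/-- The derivative at the identity of a map `F : G → G` with `F 1 = 1`, in coordinates. -/
noncomputable def derivOne (F : G → G) : E →L[ℂ] E :=
  fderiv ℂ (fun v : E ↦ coord E (F (coordSymm G v))) 0

variable {E} [LieGroup 𝓘(ℂ, E) ω G]

theorem hasFDerivAt_derivOne {F : G → G} (hF : ContMDiffAt 𝓘(ℂ, E) 𝓘(ℂ, E) ω F 1) (h1 : F 1 = 1) :
    HasFDerivAt (fun v : E ↦ coord E (F (coordSymm G v))) (derivOne E F) 0 := by
  have h : ContMDiffAt 𝓘(ℂ, E) 𝓘(ℂ, E) ω (fun v : E ↦ F (coordSymm G v)) 0 :=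
    ContMDiffAt.comp_of_eq hF (contMDiffAt_coordSymm G) coordSymm_zero
  exact ((contDiffAt_coord_comp h (by simpa using h1)).differentiableAt (by simp)).hasFDerivAt

/-- The chain rule for maps fixing the identity. -/
theorem hasFDerivAt_coord_comp {X : Type*} [NormedAddCommGroup X] [NormedSpace ℂ X] {F : G → G}
    (hF : ContMDiffAt 𝓘(ℂ, E) 𝓘(ℂ, E) ω F 1) (h1 : F 1 = 1) {a : X → G} {x : X} {A : X →L[ℂ] E}
    (hax : a x = 1) (hac : ContinuousAt a x) (hA : HasFDerivAt (fun y ↦ coord E (a y)) A x) :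
    HasFDerivAt (fun y ↦ coord E (F (a y))) ((derivOne E F).comp A) x :=
  hasFDerivAt_comp_of_eq_one (Φ := fun g ↦ coord E (F g))
    (ContMDiffAt.comp_of_eq (contMDiffAt_coord E) hF h1) hax hac hA

theorem derivOne_comp {F F' : G → G} (hF : ContMDiffAt 𝓘(ℂ, E) 𝓘(ℂ, E) ω F 1) (h1 : F 1 = 1)
    (hF' : ContMDiffAt 𝓘(ℂ, E) 𝓘(ℂ, E) ω F' 1) (h1' : F' 1 = 1) :
    derivOne E (fun g ↦ F (F' g)) = (derivOne E F).comp (derivOne E F') := by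
  have h2 : ContinuousAt (fun v : E ↦ F' (coordSymm G v)) 0 :=
    ContinuousAt.comp_of_eq hF'.continuousAt (contMDiffAt_coordSymm G).continuousAt coordSymm_zero
  exact (hasFDerivAt_coord_comp hF h1 (by simpa using h1') h2
    (hasFDerivAt_derivOne hF' h1')).fderiv

theorem derivOne_mul {F F' : G → G} (hF : ContMDiffAt 𝓘(ℂ, E) 𝓘(ℂ, E) ω F 1) (h1 : F 1 = 1)
    (hF' : ContMDiffAt 𝓘(ℂ, E) 𝓘(ℂ, E) ω F' 1) (h1' : F' 1 = 1) :
    derivOne E (fun g ↦ F g * F' g) = derivOne E F + derivOne E F' := by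
  have h2 : ContinuousAt (fun v : E ↦ F (coordSymm G v)) 0 :=
    ContinuousAt.comp_of_eq hF.continuousAt (contMDiffAt_coordSymm G).continuousAt coordSymm_zero
  have h2' : ContinuousAt (fun v : E ↦ F' (coordSymm G v)) 0 :=
    ContinuousAt.comp_of_eq hF'.continuousAt (contMDiffAt_coordSymm G).continuousAt coordSymm_zero
  exact (hasFDerivAt_coord_mul (by simpa using h1) (by simpa using h1') h2 h2'
    (hasFDerivAt_derivOne hF h1) (hasFDerivAt_derivOne hF' h1')).fderiv

omit [LieGroup 𝓘(ℂ, E) ω G] in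
theorem derivOne_eq_zero_of_forall_eq_one {F : G → G} (hF : ∀ g, F g = 1) : derivOne E F = 0 := by
  simp [derivOne, hF]

namespace IsHolomorphicRetract

variable {K : Subgroup G} {r : G → G}

omit [LieGroup 𝓘(ℂ, E) ω G] in
theorem apply_one (hr : IsHolomorphicRetract E K r) : r 1 = 1 := hr.apply_of_mem 1 K.one_mem

omit [LieGroup 𝓘(ℂ, E) ω G] in
theorem apply_apply (hr : IsHolomorphicRetract E K r) (g : G) : r (r g) = r g :=
  hr.apply_of_mem _ (hr.mem g)

theorem contMDiff_conj (hr : IsHolomorphicRetract E K r) (k : G) :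
    ContMDiff 𝓘(ℂ, E) 𝓘(ℂ, E) ω (fun g ↦ k * r g * k⁻¹) :=
  (contMDiff_const.mul hr.contMDiff).mul contMDiff_const

theorem contMDiff_commutator (hr : IsHolomorphicRetract E K r) (k : G) :
    ContMDiff 𝓘(ℂ, E) 𝓘(ℂ, E) ω (fun g ↦ k * r g * k⁻¹ * (r g)⁻¹) :=
  (hr.contMDiff_conj k).mul hr.contMDiff.inv

open scoped commutatorElement in
/-- If a map `F` factoring through `r` has nonzero derivative and kills the `j`-th term of the lower
central series, then composing it with commutators, at most `j` times, one reaches a map with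
nonzero derivative whose composition with any further commutator has derivative zero. -/
theorem exists_derivOne_ne_zero_of_lowerCentralSeries (hr : IsHolomorphicRetract E K r) (j : ℕ) :
    ∀ F : G → G, ContMDiff 𝓘(ℂ, E) 𝓘(ℂ, E) ω F → F 1 = 1 → (∀ g, F (r g) = F g) →
      derivOne E F ≠ 0 →
      (∀ x ∈ K, x ∈ Subgroup.lowerCentralSeries (⊤ : Subgroup G) j → F x = 1) →
      ∃ F' : G → G, ContMDiff 𝓘(ℂ, E) 𝓘(ℂ, E) ω F' ∧ F' 1 = 1 ∧ (∀ g, F' (r g) = F' g) ∧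
        derivOne E F' ≠ 0 ∧
        ∀ k ∈ K, derivOne E (fun g ↦ F' (k * r g * k⁻¹ * (r g)⁻¹)) = 0 := by
  induction j with
  | zero =>
    intro F _ _ hFr hne hF
    refine absurd (derivOne_eq_zero_of_forall_eq_one fun g ↦ ?_) hne
    rw [← hFr]
    exact hF _ (hr.mem g) (by simp)
  | succ j ih =>
    intro F hFs hF1 hFr hne hF
    by_cases hall : ∀ k ∈ K, derivOne E (fun g ↦ F (k * r g * k⁻¹ * (r g)⁻¹)) = 0
    · exact ⟨F, hFs, hF1, hFr, hne, hall⟩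
    push Not at hall
    obtain ⟨k, hk, hkne⟩ := hall
    refine ih _ (hFs.comp (hr.contMDiff_commutator k)) ?_ ?_ hkne ?_
    · simp [hr.apply_one, hF1]
    · intro g
      simp [hr.apply_apply]
    · intro x hx hxj
      refine hF _ (K.mul_mem (K.mul_mem (K.mul_mem hk (hr.mem x)) (K.inv_mem hk))
        (K.inv_mem (hr.mem x))) ?_
      show k * r x * k⁻¹ * (r x)⁻¹ ∈ _
      rw [hr.apply_of_mem x hx]
      have h1 : ⁅x, k⁆ ∈ Subgroup.lowerCentralSeries (⊤ : Subgroup G) (j + 1) :=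
        Subgroup.commutator_mem_commutator hxj (Subgroup.mem_top k)
      have h2 := Subgroup.inv_mem _ h1
      rwa [commutatorElement_inv, commutatorElement_def] at h2

/-- On a nontrivial retract of a nilpotent group there is a nonzero linear form on the tangent space
at the identity which is invariant under the adjoint action: the operators `Ad k - 1` are the
derivatives of the commutator maps, so long products of them vanish. -/
theorem exists_invariant_functional [Group.IsNilpotent G] (hr : IsHolomorphicRetract E K r)
    (hne : derivOne E r ≠ 0) :
    ∃ ℓ : E →L[ℂ] ℂ, ℓ ≠ 0 ∧ ℓ.comp (derivOne E r) = ℓ ∧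
      ∀ k ∈ K, ℓ.comp (derivOne E (fun g ↦ k * r g * k⁻¹)) = ℓ := by
  obtain ⟨c, hc⟩ := Subgroup.nilpotent_iff_lowerCentralSeries.mp
    (inferInstance : Group.IsNilpotent G)
  obtain ⟨F, hFs, hF1, hFr, hFne, hFk⟩ := hr.exists_derivOne_ne_zero_of_lowerCentralSeries c r
    hr.contMDiff hr.apply_one hr.apply_apply hne (by
      intro x _ hx
      rw [hc, Subgroup.mem_bot] at hx
      rw [hx, hr.apply_one])
  obtain ⟨v, hv⟩ : ∃ v, derivOne E F v ≠ 0 := by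
    by_contra! h
    exact hFne (ContinuousLinearMap.ext h)
  obtain ⟨lam, hlam⟩ := SeparatingDual.exists_ne_zero (R := ℂ) hv
  have hlp : (lam.comp (derivOne E F)).comp (derivOne E r) = lam.comp (derivOne E F) := by
    have h := derivOne_comp (hFs 1) hF1 (hr.contMDiff 1) hr.apply_one
    simp only [hFr] at h
    rw [ContinuousLinearMap.comp_assoc, ← h]
  refine ⟨lam.comp (derivOne E F), fun h ↦ hlam ?_, hlp, fun k hk ↦ ?_⟩
  · simpa using congrArg (fun L ↦ L v) h
  · have hc1 : k * r 1 * k⁻¹ * (r 1)⁻¹ = 1 := by simp [hr.apply_one]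
    have h1 : derivOne E (fun g ↦ k * r g * k⁻¹)
        = derivOne E (fun g ↦ k * r g * k⁻¹ * (r g)⁻¹) + derivOne E r := by
      rw [← derivOne_mul (hr.contMDiff_commutator k 1) hc1 (hr.contMDiff 1) hr.apply_one]
      simp
    have h2 := derivOne_comp (hFs 1) hF1 (hr.contMDiff_commutator k 1) hc1
    rw [hFk k hk] at h2
    rw [h1, ContinuousLinearMap.comp_add, hlp, ContinuousLinearMap.comp_assoc, ← h2,
      ContinuousLinearMap.comp_zero, zero_add]

end IsHolomorphicRetract

end Retracts

end ComplexNil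

namespace ComplexNil

/-! ### The invariant one-form on a retract -/

section InvariantForm

open Filter Topology

variable {E : Type*} [NormedAddCommGroup E] [NormedSpace ℂ E]
  {G : Type*} [TopologicalSpace G] [ChartedSpace E G] [Group G]

/-- The linear form `ℓ` applied to the coordinates of `(r x)⁻¹ * r g`. Its derivative at `g = x` is
the value at `x` of the left-invariant one-form on the retract with value `ℓ` at the identity. -/
noncomputable def invariantPotential (ℓ : E →L[ℂ] ℂ) (r : G → G) (x g : G) : ℂ :=
  ℓ (coord E ((r x)⁻¹ * r g))

/-- The left-invariant one-form with value `ℓ` at the identity, pulled back from the retract to the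
coordinate chart at the identity. It is meaningful near `0` only. -/
noncomputable def invariantForm (ℓ : E →L[ℂ] ℂ) (r : G → G) (x : E) : E →L[ℂ] ℂ :=
  fderiv ℂ (fun y ↦ invariantPotential ℓ r (coordSymm G x) (coordSymm G y)) x

namespace IsHolomorphicRetract

variable [LieGroup 𝓘(ℂ, E) ω G] {K : Subgroup G} {r : G → G} {ℓ : E →L[ℂ] ℂ}

theorem contMDiffAt_invariantPotential (hr : IsHolomorphicRetract E K r) (x : G) :
    ContMDiffAt 𝓘(ℂ, E) 𝓘(ℂ, ℂ) ω (invariantPotential ℓ r x) x := by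
  have h1 : ContMDiffAt 𝓘(ℂ, E) 𝓘(ℂ, E) ω (fun g ↦ (r x)⁻¹ * r g) x :=
    (contMDiff_const.mul hr.contMDiff) x
  have h2 : ContMDiffAt 𝓘(ℂ, E) 𝓘(ℂ, E) ω (fun g ↦ coord E ((r x)⁻¹ * r g)) x :=
    ContMDiffAt.comp_of_eq (contMDiffAt_coord E) h1 (by simp)
  exact ℓ.contMDiff.contMDiffAt.comp x h2

variable (G) in
theorem eventually_contMDiffAt_coordSymm :
    ∀ᶠ x in 𝓝 (0 : E), ContMDiffAt 𝓘(ℂ, E) 𝓘(ℂ, E) ω (coordSymm G : E → G) x :=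
  (contMDiffAt_iff_contMDiffAt_nhds (by simp)).mp (contMDiffAt_coordSymm G)

theorem hasFDerivAt_invariantForm (hr : IsHolomorphicRetract E K r) {x : E}
    (hx : ContMDiffAt 𝓘(ℂ, E) 𝓘(ℂ, E) ω (coordSymm G : E → G) x) :
    HasFDerivAt (fun y ↦ invariantPotential ℓ r (coordSymm G x) (coordSymm G y))
      (invariantForm ℓ r x) x := by
  have h := ContMDiffAt.comp x (hr.contMDiffAt_invariantPotential (ℓ := ℓ) _) hx
  rw [contMDiffAt_iff_contDiffAt] at h
  exact (h.differentiableAt (by simp)).hasFDerivAt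

/-- The invariant one-form is analytic. -/
theorem analyticAt_invariantForm [CompleteSpace E] (hr : IsHolomorphicRetract E K r) :
    AnalyticAt ℂ (invariantForm ℓ r : E → E →L[ℂ] ℂ) 0 := by
  set φ : E × E → ℂ := fun p ↦ invariantPotential ℓ r (coordSymm G p.1) (coordSymm G p.2) with hφ
  have hψ1 : ContMDiffAt 𝓘(ℂ, E × E) 𝓘(ℂ, E) ω (fun p : E × E ↦ coordSymm G p.1) (0, 0) :=
    ContMDiffAt.comp (0, 0) (f := Prod.fst) (contMDiffAt_coordSymm G)
      contDiff_fst.contMDiff.contMDiffAt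
  have hψ2 : ContMDiffAt 𝓘(ℂ, E × E) 𝓘(ℂ, E) ω (fun p : E × E ↦ coordSymm G p.2) (0, 0) :=
    ContMDiffAt.comp (0, 0) (f := Prod.snd) (contMDiffAt_coordSymm G)
      contDiff_snd.contMDiff.contMDiffAt
  have h1 : ContMDiffAt 𝓘(ℂ, E × E) 𝓘(ℂ, E) ω
      (fun p : E × E ↦ (r (coordSymm G p.1))⁻¹ * r (coordSymm G p.2)) (0, 0) :=
    ((hr.contMDiff _).comp (0, 0) hψ1).inv.mul ((hr.contMDiff _).comp (0, 0) hψ2)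
  have h2 : ContDiffAt ℂ ω φ (0, 0) :=
    ℓ.contDiff.contDiffAt.comp _ (contDiffAt_coord_comp h1 (by simp))
  have h3 : AnalyticAt ℂ φ (0, 0) := h2.analyticAt
  have h4 :
      AnalyticAt ℂ (fun x : E ↦ (fderiv ℂ φ (x, x)).comp (ContinuousLinearMap.inr ℂ E E)) 0 := by
    have h5 : AnalyticAt ℂ (fun x : E ↦ fderiv ℂ φ (x, x)) 0 :=
      AnalyticAt.comp (g := fderiv ℂ φ) (f := fun x : E ↦ (x, x)) h3.fderiv
        (analyticAt_id.prod analyticAt_id)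
    exact ((ContinuousLinearMap.compL ℂ E (E × E) ℂ).flip
      (ContinuousLinearMap.inr ℂ E E)).analyticAt _ |>.comp h5
  refine h4.congr ?_
  have h5 : Tendsto (fun x : E ↦ (x, x)) (𝓝 0) (𝓝 (0, 0)) := by
    have : ContinuousAt (fun x : E ↦ (x, x)) 0 := by fun_prop
    exact this
  filter_upwards [h5.eventually h3.eventually_analyticAt] with x hx
  exact (HasFDerivAt.comp x (f := fun y : E ↦ (x, y)) hx.differentiableAt.hasFDerivAt
    (hasFDerivAt_prodMk_right x x)).fderiv.symm

/-- The invariant one-form is preserved by left translations. -/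
theorem eventually_pullback_translation (hr : IsHolomorphicRetract E K r) {x₁ : E}
    (hx₁ : ContMDiffAt 𝓘(ℂ, E) 𝓘(ℂ, E) ω (coordSymm G : E → G) x₁) :
    ContDiffAt ℂ ω (fun y ↦ coord E ((r (coordSymm G x₁))⁻¹ * r (coordSymm G y))) x₁ ∧
    ∀ᶠ x in 𝓝 x₁, invariantForm ℓ r x =
      (invariantForm ℓ r (coord E ((r (coordSymm G x₁))⁻¹ * r (coordSymm G x)))).comp
        (fderiv ℂ (fun y ↦ coord E ((r (coordSymm G x₁))⁻¹ * r (coordSymm G y))) x) := by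
  set b : G := r (coordSymm G x₁) with hb
  have hbK : b ∈ K := hr.mem _
  set a : E → G := fun y ↦ b⁻¹ * r (coordSymm G y) with ha
  have haC : ContMDiffAt 𝓘(ℂ, E) 𝓘(ℂ, E) ω a x₁ :=
    contMDiffAt_const.mul ((hr.contMDiff _).comp x₁ hx₁)
  have hax : a x₁ = 1 := by simp [ha, hb]
  have hαC : ContDiffAt ℂ ω (fun y ↦ coord E (a y)) x₁ := contDiffAt_coord_comp haC hax
  refine ⟨hαC, ?_⟩
  have hat : Tendsto a (𝓝 x₁) (𝓝 1) := hax ▸ haC.continuousAt.tendsto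
  have hαt : Tendsto (fun y ↦ coord E (a y)) (𝓝 x₁) (𝓝 0) := by
    have := hαC.continuousAt.tendsto
    rwa [hax, coord_one] at this
  have hψa : ∀ᶠ y in 𝓝 x₁, coordSymm G (coord E (a y)) = a y :=
    hat.eventually (eventually_coordSymm_coord E)
  have hαd : ∀ᶠ x in 𝓝 x₁, DifferentiableAt ℂ (fun y ↦ coord E (a y)) x :=
    (hαC.eventually (by simp)).mono fun x hx ↦ hx.differentiableAt (by simp)
  filter_upwards [hψa, hψa.eventually_nhds, hαd,
    hαt.eventually (eventually_contMDiffAt_coordSymm G)] with x h1 h2 h3 h4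
  have h5 := HasFDerivAt.comp x (f := fun y ↦ coord E (a y))
    (hr.hasFDerivAt_invariantForm (ℓ := ℓ) h4) h3.hasFDerivAt
  have hra : ∀ y, r (a y) = a y := fun y ↦
    hr.apply_of_mem _ (K.mul_mem (K.inv_mem hbK) (hr.mem _))
  rw [← h5.fderiv]
  refine Filter.EventuallyEq.fderiv_eq ?_
  filter_upwards [h2] with y hy
  simp only [Function.comp_apply, invariantPotential, h1, hy, hra]
  congr 2
  simp only [ha]
  group

/-- The inversion changes the sign of the invariant one-form, because that form is invariant under
the adjoint action, hence under right translations too. -/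
theorem eventually_pullback_inv (hr : IsHolomorphicRetract E K r)
    (hℓ : ∀ k ∈ K, ℓ.comp (derivOne E (fun g ↦ k * r g * k⁻¹)) = ℓ) :
    ∀ᶠ x in 𝓝 (0 : E), (-1 : ℂ) • invariantForm ℓ r x =
      (invariantForm ℓ r (coord E (r (coordSymm G x))⁻¹)).comp
        (fderiv ℂ (fun y ↦ coord E (r (coordSymm G y))⁻¹) x) := by
  have : IsTopologicalGroup G := topologicalGroup_of_lieGroup 𝓘(ℂ, E) ω
  set a : E → G := fun y ↦ (r (coordSymm G y))⁻¹ with ha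
  have haC : ContMDiffAt 𝓘(ℂ, E) 𝓘(ℂ, E) ω a 0 :=
    ((hr.contMDiff _).comp 0 (contMDiffAt_coordSymm G)).inv
  have hax : a 0 = 1 := by simp [ha, hr.apply_one]
  have hαC : ContDiffAt ℂ ω (fun y ↦ coord E (a y)) 0 := contDiffAt_coord_comp haC hax
  have hat : Tendsto a (𝓝 0) (𝓝 1) := hax ▸ haC.continuousAt.tendsto
  have hαt : Tendsto (fun y ↦ coord E (a y)) (𝓝 0) (𝓝 0) := by
    have := hαC.continuousAt.tendsto
    rwa [hax, coord_one] at this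
  have hψa : ∀ᶠ y in 𝓝 0, coordSymm G (coord E (a y)) = a y :=
    hat.eventually (eventually_coordSymm_coord E)
  have hαd : ∀ᶠ x in 𝓝 0, DifferentiableAt ℂ (fun y ↦ coord E (a y)) x :=
    (hαC.eventually (by simp)).mono fun x hx ↦ hx.differentiableAt (by simp)
  filter_upwards [hψa, hψa.eventually_nhds, hαd,
    hαt.eventually (eventually_contMDiffAt_coordSymm G),
    eventually_contMDiffAt_coordSymm G] with x h1 h2 h3 h4 h6
  have h5 := HasFDerivAt.comp x (f := fun y ↦ coord E (a y))
    (hr.hasFDerivAt_invariantForm (ℓ := ℓ) h4) h3.hasFDerivAt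
  have hra : ∀ y, r (a y) = a y := fun y ↦ hr.apply_of_mem _ (K.inv_mem (hr.mem _))
  rw [← h5.fderiv]
  -- conjugating by `k` turns the left difference `d` into the right one
  set k : G := r (coordSymm G x) with hk
  have hkK : k ∈ K := hr.mem _
  set d : E → G := fun y ↦ k⁻¹ * r (coordSymm G y) with hd
  have hdK : ∀ y, r (d y) = d y := fun y ↦
    hr.apply_of_mem _ (K.mul_mem (K.inv_mem hkK) (hr.mem _))
  have hdx : d x = 1 := by simp [hd, hk]
  have hdC : ContMDiffAt 𝓘(ℂ, E) 𝓘(ℂ, E) ω d x :=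
    contMDiffAt_const.mul ((hr.contMDiff _).comp x h6)
  have hdD : HasFDerivAt (fun y ↦ coord E (d y)) (fderiv ℂ (fun y ↦ coord E (d y)) x) x :=
    ((contDiffAt_coord_comp hdC hdx).differentiableAt (by simp)).hasFDerivAt
  have hθ : invariantForm ℓ r x = ℓ.comp (fderiv ℂ (fun y ↦ coord E (d y)) x) := by
    rw [← (ℓ.hasFDerivAt.comp x hdD).fderiv]
    rfl
  have hconj := hasFDerivAt_coord_comp (hr.contMDiff_conj k 1) (by simp [hr.apply_one]) hdx
    hdC.continuousAt hdD
  have hcC : ContMDiffAt 𝓘(ℂ, E) 𝓘(ℂ, E) ω (fun y ↦ k * r (d y) * k⁻¹) x :=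
    ((hr.contMDiff_conj k) (d x)).comp x hdC
  have hinv := hasFDerivAt_coord_inv (by simp [hdx, hr.apply_one]) hcC
  rw [hconj.fderiv] at hinv
  have h7 := (ℓ.hasFDerivAt.comp x hinv).fderiv
  rw [ContinuousLinearMap.comp_neg, ← ContinuousLinearMap.comp_assoc, hℓ k hkK, ← hθ] at h7
  have h8 : (-1 : ℂ) • invariantForm ℓ r x = -invariantForm ℓ r x := by
    ext v
    simp
  refine h8.trans (h7.symm.trans ?_)
  refine Filter.EventuallyEq.fderiv_eq ?_
  filter_upwards [h2] with y hy
  simp only [Function.comp_apply, invariantPotential, h1, hy, hra, hdK]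
  congr 2
  simp only [ha, hd, ← hk]
  group

/-- The invariant one-form attached to an invariant functional is closed. -/
theorem eventually_fderiv_invariantForm_symm [CompleteSpace E] (hr : IsHolomorphicRetract E K r)
    (hℓ : ∀ k ∈ K, ℓ.comp (derivOne E (fun g ↦ k * r g * k⁻¹)) = ℓ) :
    ∀ᶠ x in 𝓝 (0 : E), ∀ u v, fderiv ℂ (invariantForm ℓ r) x u v
      = fderiv ℂ (invariantForm ℓ r) x v u := by
  have hθ := hr.analyticAt_invariantForm (ℓ := ℓ)
  have hψ0 := contMDiffAt_coordSymm (E := E) G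
  have haC : ContMDiffAt 𝓘(ℂ, E) 𝓘(ℂ, E) ω (fun y : E ↦ r (coordSymm G y)) 0 :=
    (hr.contMDiff _).comp 0 hψ0
  have hα0 : coord E (r (coordSymm G (0 : E)))⁻¹ = 0 := by simp [hr.apply_one]
  have hzero : ∀ u v, fderiv ℂ (invariantForm ℓ r) 0 u v
      = fderiv ℂ (invariantForm ℓ r) 0 v u := by
    intro u v
    obtain ⟨h1, h2⟩ := hr.eventually_pullback_translation (ℓ := ℓ) hψ0
    have hβ0 : coord E ((r (coordSymm G (0 : E)))⁻¹ * r (coordSymm G (0 : E))) = 0 := by simp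
    have h3 := fderiv_antisymm_of_pullback (c := 1) hθ.differentiableAt
      (by rw [hβ0]; exact hθ.differentiableAt) h1
      (h2.mono fun x hx ↦ by rw [one_smul]; exact hx) u v
    have h4 := fderiv_antisymm_of_pullback (c := -1) hθ.differentiableAt
      (by rw [hα0]; exact hθ.differentiableAt)
      (contDiffAt_coord_comp haC.inv (by simp [hr.apply_one])) (hr.eventually_pullback_inv hℓ) u v
    have h5 := (hasFDerivAt_coord_inv (by simp [hr.apply_one]) haC).fderiv
    rw [hα0, h5] at h4
    rw [hβ0] at h3
    simp only [coordSymm_zero, hr.apply_one, inv_one, one_mul] at h3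
    simp only [neg_apply, map_neg, neg_neg, one_smul, neg_smul] at h3 h4
    linear_combination (1 / 2 : ℂ) * h3 - (1 / 2 : ℂ) * h4
  filter_upwards [hθ.eventually_analyticAt, eventually_contMDiffAt_coordSymm G] with x hx hψx u v
  obtain ⟨h1, h2⟩ := hr.eventually_pullback_translation (ℓ := ℓ) hψx
  have hβ0 : coord E ((r (coordSymm G x))⁻¹ * r (coordSymm G x)) = 0 := by simp
  have h3 := fderiv_antisymm_of_pullback (c := 1) hx.differentiableAt
      (by rw [hβ0]; exact hθ.differentiableAt) h1
      (h2.mono fun x hx ↦ by rw [one_smul]; exact hx) u v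
  rw [hβ0, hzero, sub_self, one_smul] at h3
  exact sub_eq_zero.mp h3

/-- The invariant one-form has an analytic primitive near the identity. -/
theorem exists_primitive_invariantForm [CompleteSpace E] (hr : IsHolomorphicRetract E K r)
    (hℓ : ∀ k ∈ K, ℓ.comp (derivOne E (fun g ↦ k * r g * k⁻¹)) = ℓ) :
    ∃ h : E → ℂ, AnalyticAt ℂ h 0 ∧
      ∀ᶠ x in 𝓝 (0 : E), HasFDerivAt h (invariantForm ℓ r x) x := by
  have hθ := hr.analyticAt_invariantForm (ℓ := ℓ)
  obtain ⟨ε, hε, hball⟩ := Metric.eventually_nhds_iff_ball.mp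
    (hθ.eventually_analyticAt.and (hr.eventually_fderiv_invariantForm_symm hℓ))
  obtain ⟨h, hh⟩ := (convex_ball (0 : E) ε).exists_forall_hasFDerivAt_of_fderiv_symmetric
    (𝕜 := ℂ) Metric.isOpen_ball (show DifferentiableOn ℝ (invariantForm ℓ r : E → E →L[ℂ] ℂ) _ from
      fun x hx ↦ ((hball x hx).1.differentiableAt.restrictScalars ℝ).differentiableWithinAt)
    (fun x hx u v ↦ by
      rw [(hball x hx).1.differentiableAt.fderiv_restrictScalars ℝ]
      exact (hball x hx).2 u v)
  have hev : ∀ᶠ x in 𝓝 (0 : E), HasFDerivAt h (invariantForm ℓ r x) x := by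
    filter_upwards [Metric.ball_mem_nhds (0 : E) hε] with x hx using hh x hx
  exact ⟨h, analyticAt_of_hasFDerivAt hθ hev, hev⟩

end IsHolomorphicRetract

end InvariantForm

end ComplexNil

namespace ComplexNil

/-! ### Integrating the invariant form to a homomorphism -/

section Integration

open Filter Topology

variable {E : Type*} [NormedAddCommGroup E] [NormedSpace ℂ E]
  {G : Type*} [TopologicalSpace G] [ChartedSpace E G]

variable {Y : Type*} [NormedAddCommGroup Y] [NormedSpace ℂ Y]

theorem hasMFDerivAt_zero_comp {E' : Type*} [NormedAddCommGroup E'] [NormedSpace ℂ E']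
    {N : Type*} [TopologicalSpace N] [ChartedSpace E' N] {f : G → Y} {T : N → G} {x : N}
    (hf : HasMFDerivAt 𝓘(ℂ, E) 𝓘(ℂ, Y) f (T x) 0)
    (hT : MDifferentiableAt 𝓘(ℂ, E') 𝓘(ℂ, E) T x) :
    HasMFDerivAt 𝓘(ℂ, E') 𝓘(ℂ, Y) (fun y ↦ f (T y)) x 0 := by
  have h := hf.comp x hT.hasMFDerivAt
  rwa [ContinuousLinearMap.zero_comp] at h

theorem hasMFDerivAt_zero_sub {f f' : G → Y} {x : G}
    (hf : HasMFDerivAt 𝓘(ℂ, E) 𝓘(ℂ, Y) f x 0) (hf' : HasMFDerivAt 𝓘(ℂ, E) 𝓘(ℂ, Y) f' x 0) :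
    HasMFDerivAt 𝓘(ℂ, E) 𝓘(ℂ, Y) (fun y ↦ f y - f' y) x 0 := by
  have h := hf.sub hf'
  exact h.congr_mfderiv (sub_zero (0 : E →L[ℂ] Y))

/-- A function whose derivative vanishes near a point is constant near that point. -/
theorem eventually_eq_of_hasMFDerivAt_zero [IsManifold 𝓘(ℂ, E) 1 G] {f : G → Y} {x : G}
    (hf : ∀ᶠ y in 𝓝 x, HasMFDerivAt 𝓘(ℂ, E) 𝓘(ℂ, Y) f y 0) : ∀ᶠ y in 𝓝 x, f y = f x := by
  set e := chartAt E x with he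
  have hx : x ∈ e.source := mem_chart_source E x
  have h1 : Tendsto e.symm (𝓝 (e x)) (𝓝 x) := by
    have := e.continuousAt_symm (e.map_source hx)
    rwa [ContinuousAt, e.left_inv hx] at this
  obtain ⟨ε, hε, hball⟩ := Metric.eventually_nhds_iff_ball.mp
    ((h1.eventually hf).and (e.open_target.mem_nhds (e.map_source hx)))
  have hd : ∀ v ∈ Metric.ball (e x) ε, HasFDerivAt (fun v ↦ f (e.symm v)) (0 : E →L[ℂ] Y) v := by
    intro v hv
    obtain ⟨h2, h3⟩ := hball v hv
    have h4 : MDifferentiableAt 𝓘(ℂ, E) 𝓘(ℂ, E) e.symm v :=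
      mdifferentiableAt_atlas_symm (chart_mem_atlas E x) h3
    exact hasMFDerivAt_iff_hasFDerivAt.mp (hasMFDerivAt_zero_comp h2 h4)
  have hconst : ∀ v ∈ Metric.ball (e x) ε, f (e.symm v) = f (e.symm (e x)) := by
    intro v hv
    refine (convex_ball (e x) ε).is_const_of_fderivWithin_eq_zero (𝕜 := ℂ)
      (fun w hw ↦ (hd w hw).differentiableAt.differentiableWithinAt) (fun w hw ↦ ?_) hv
      (Metric.mem_ball_self hε)
    exact (hd w hw).hasFDerivWithinAt.fderivWithin (Metric.isOpen_ball.uniqueDiffWithinAt hw)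
  filter_upwards [e.open_source.mem_nhds hx, (e.continuousAt hx).eventually
    (Metric.ball_mem_nhds (e x) hε)] with y hy hy'
  have := hconst _ hy'
  rwa [e.left_inv hy, e.left_inv hx] at this

theorem eq_of_hasMFDerivAt_zero [IsManifold 𝓘(ℂ, E) 1 G] [PreconnectedSpace G] {f : G → Y}
    (hf : ∀ x, HasMFDerivAt 𝓘(ℂ, E) 𝓘(ℂ, Y) f x 0) (x y : G) : f x = f y :=
  IsLocallyConstant.apply_eq_of_preconnectedSpace ((IsLocallyConstant.iff_eventually_eq f).mpr
    fun _ ↦ eventually_eq_of_hasMFDerivAt_zero (Eventually.of_forall hf)) x y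

variable [Group G]

/-- The function `f` has at `x` the derivative prescribed by the invariant one-form on the retract
with value `ℓ` at the identity. -/
def IsPrimitiveAt (ℓ : E →L[ℂ] ℂ) (r : G → G) (f : G → ℂ) (x : G) : Prop :=
  HasMFDerivAt 𝓘(ℂ, E) 𝓘(ℂ, ℂ) (fun g ↦ f g - invariantPotential ℓ r x g) x 0

namespace IsPrimitiveAt

variable {ℓ : E →L[ℂ] ℂ} {r : G → G} {f f' : G → ℂ} {x : G}

theorem hasMFDerivAt_sub (hf : IsPrimitiveAt ℓ r f x) (hf' : IsPrimitiveAt ℓ r f' x) :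
    HasMFDerivAt 𝓘(ℂ, E) 𝓘(ℂ, ℂ) (fun g ↦ f g - f' g) x 0 := by
  exact (hasMFDerivAt_zero_sub hf hf').congr_of_eventuallyEq
    (Eventually.of_forall fun g ↦ by simp)

theorem sub_const (hf : IsPrimitiveAt ℓ r f x) (c : ℂ) :
    IsPrimitiveAt ℓ r (fun g ↦ f g - c) x := by
  have h := hasMFDerivAt_zero_sub hf (hasMFDerivAt_const (I := 𝓘(ℂ, E)) (I' := 𝓘(ℂ, ℂ)) c x)
  exact h.congr_of_eventuallyEq (Eventually.of_forall fun g ↦ by ring)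

theorem congr_of_eventually_sub_eq (hf : IsPrimitiveAt ℓ r f x)
    (h : ∀ᶠ g in 𝓝 x, f' g - f g = f' x - f x) : IsPrimitiveAt ℓ r f' x := by
  refine (hf.sub_const (f x - f' x)).congr_of_eventuallyEq ?_
  filter_upwards [h] with g hg
  linear_combination hg

end IsPrimitiveAt

namespace IsHolomorphicRetract

variable [LieGroup 𝓘(ℂ, E) ω G] {K : Subgroup G} {r : G → G} {ℓ : E →L[ℂ] ℂ}

/-- The form is invariant under the retraction followed by left translations. -/
theorem isPrimitiveAt_translate (hr : IsHolomorphicRetract E K r) {k : G} (hk : k ∈ K) {f : G → ℂ}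
    {x : G} (hf : IsPrimitiveAt ℓ r f (k * r x)) : IsPrimitiveAt ℓ r (fun g ↦ f (k * r g)) x := by
  have h := hasMFDerivAt_zero_comp (T := fun g ↦ k * r g) hf
    (((contMDiff_const (c := k)).mul hr.contMDiff).mdifferentiableAt (by simp))
  refine h.congr_of_eventuallyEq (Eventually.of_forall fun g ↦ ?_)
  have hT : ∀ g, r (k * r g) = k * r g := fun g ↦ hr.apply_of_mem _ (K.mul_mem hk (hr.mem g))
  simp only [invariantPotential, hT]
  congr 3
  group

theorem exists_primitive_near_one [CompleteSpace E] (hr : IsHolomorphicRetract E K r)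
    (hℓ : ∀ k ∈ K, ℓ.comp (derivOne E (fun g ↦ k * r g * k⁻¹)) = ℓ) :
    ∃ H : G → ℂ, ContMDiffAt 𝓘(ℂ, E) 𝓘(ℂ, ℂ) ω H 1 ∧ ∀ᶠ x in 𝓝 (1 : G), IsPrimitiveAt ℓ r H x := by
  obtain ⟨h, hh, hprim⟩ := hr.exists_primitive_invariantForm hℓ
  refine ⟨fun g ↦ h (coord E g), ?_, ?_⟩
  · have h1 : ContMDiffAt 𝓘(ℂ, E) 𝓘(ℂ, ℂ) ω h 0 := contMDiffAt_iff_contDiffAt.mpr hh.contDiffAt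
    exact ContMDiffAt.comp_of_eq h1 (contMDiffAt_coord E) coord_one
  have hc : Tendsto (coord E) (𝓝 (1 : G)) (𝓝 0) := by
    have := (contMDiffAt_coord (G := G) E).continuousAt.tendsto
    rwa [coord_one] at this
  filter_upwards [hc.eventually hprim, hc.eventually (eventually_contMDiffAt_coordSymm G),
    eventually_coordSymm_coord E, (eventually_coordSymm_coord E).eventually_nhds,
    (contMDiffAt_iff_contMDiffAt_nhds (by simp)).mp (contMDiffAt_coord (G := G) E)]
    with x h1 h2 h3 h4 h5
  have h6 := h1.sub (hr.hasFDerivAt_invariantForm (ℓ := ℓ) h2)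
  rw [sub_self] at h6
  have h7 := hasMFDerivAt_zero_comp (T := coord E) (hasMFDerivAt_iff_hasFDerivAt.mpr h6)
    (h5.mdifferentiableAt (by simp))
  refine h7.congr_of_eventuallyEq ?_
  filter_upwards [h4] with g hg
  simp [h3, hg]

/-- On a simply connected group, the invariant form attached to an invariant functional is the
derivative of a global function, and that function restricts to a homomorphism on the retract. -/
theorem exists_homomorphism [CompleteSpace E] [SimplyConnectedSpace G]
    (hr : IsHolomorphicRetract E K r) (hp : ℓ.comp (derivOne E r) = ℓ)
    (hℓ : ∀ k ∈ K, ℓ.comp (derivOne E (fun g ↦ k * r g * k⁻¹)) = ℓ) :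
    ∃ f : G → ℂ, ContMDiff 𝓘(ℂ, E) 𝓘(ℂ, ℂ) ω f ∧ f 1 = 0 ∧ (∀ g, f (r g) = f g) ∧
      (∀ k ∈ K, ∀ g, f (k * r g) = f k + f g) ∧
      HasFDerivAt (fun v : E ↦ f (coordSymm G v)) ℓ 0 := by
  have : LocallyPathConnectedSpace G := ChartedSpace.locallyPathConnectedSpace E G
  obtain ⟨H, hH, hHprim⟩ := hr.exists_primitive_near_one hℓ
  obtain ⟨V, hV, hVo, hV1⟩ := _root_.eventually_nhds_iff.mp hHprim
  have hT : ∀ x : G, ContMDiff 𝓘(ℂ, E) 𝓘(ℂ, E) ω (fun g ↦ (r x)⁻¹ * r g) := fun x ↦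
    contMDiff_const.mul hr.contMDiff
  have hprim : ∀ x z, (r x)⁻¹ * r z ∈ V → IsPrimitiveAt ℓ r (fun g ↦ H ((r x)⁻¹ * r g)) z :=
    fun x z hz ↦ hr.isPrimitiveAt_translate (K.inv_mem (hr.mem x)) (hV _ hz)
  have hopen : ∀ x : G, IsOpen {g : G | (r x)⁻¹ * r g ∈ V} := fun x ↦
    hVo.preimage (hT x).continuous
  obtain ⟨f₀, hf₀⟩ := exists_global_of_locally_constant_differences
    (fun x : G ↦ {g : G | (r x)⁻¹ * r g ∈ V}) hopen (fun x ↦ by simpa using hV1)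
    (fun x g ↦ H ((r x)⁻¹ * r g)) (fun x y z hz ↦ by
      refine eventually_eq_of_hasMFDerivAt_zero (E := E)
        (f := fun w ↦ H ((r x)⁻¹ * r w) - H ((r y)⁻¹ * r w)) ?_
      filter_upwards [((hopen x).inter (hopen y)).mem_nhds hz] with w hw
      exact (hprim x w hw.1).hasMFDerivAt_sub (hprim y w hw.2))
  have hself : ∀ z : G, (r z)⁻¹ * r z ∈ V := fun z ↦ by simpa using hV1
  have hf₀prim : ∀ z, IsPrimitiveAt ℓ r f₀ z := fun z ↦
    (hprim z z (hself z)).congr_of_eventually_sub_eq (hf₀ z z (hself z))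
  set f : G → ℂ := fun g ↦ f₀ g - f₀ 1 with hf
  have hfprim : ∀ z, IsPrimitiveAt ℓ r f z := fun z ↦ (hf₀prim z).sub_const _
  have hf1 : f 1 = 0 := by simp [hf]
  have hconn : ∀ f' : G → ℂ, (∀ z, IsPrimitiveAt ℓ r f' z) → ∀ g, f' g = f' 1 + f g := by
    intro f' hf' g
    have h := eq_of_hasMFDerivAt_zero (fun z ↦ (hf' z).hasMFDerivAt_sub (hfprim z)) g 1
    simp only [hf1] at h
    linear_combination h
  refine ⟨f, fun z ↦ ?_, hf1, fun g ↦ ?_, fun k hk g ↦ ?_, ?_⟩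
  · have h1 : ContMDiffAt 𝓘(ℂ, E) 𝓘(ℂ, ℂ) ω (fun g ↦ H ((r z)⁻¹ * r g)) z :=
      ContMDiffAt.comp_of_eq hH (hT z z) (by simp)
    have h2 : ContMDiffAt 𝓘(ℂ, E) 𝓘(ℂ, ℂ) ω
        (fun g ↦ H ((r z)⁻¹ * r g) + (f z - H ((r z)⁻¹ * r z))) z := h1.add contMDiffAt_const
    refine h2.congr_of_eventuallyEq ?_
    filter_upwards [hf₀ z z (hself z)] with w hw
    simp only [hf]
    linear_combination hw
  · have h := hconn (fun g ↦ f (1 * r g))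
      (fun z ↦ hr.isPrimitiveAt_translate K.one_mem (hfprim _)) g
    simpa [hr.apply_one, hf1] using h
  · have h := hconn (fun g ↦ f (k * r g)) (fun z ↦ hr.isPrimitiveAt_translate hk (hfprim _)) g
    simpa [hr.apply_one] using h
  · have h1 : HasMFDerivAt 𝓘(ℂ, E) 𝓘(ℂ, ℂ)
        (fun v : E ↦ f (coordSymm G v) - invariantPotential ℓ r 1 (coordSymm G v)) 0 0 := by
      refine hasMFDerivAt_zero_comp (f := fun g ↦ f g - invariantPotential ℓ r 1 g) ?_
        ((contMDiffAt_coordSymm G).mdifferentiableAt (by simp))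
      rw [coordSymm_zero]
      exact hfprim 1
    have h2 : HasFDerivAt (fun v : E ↦ invariantPotential ℓ r 1 (coordSymm G v)) ℓ 0 := by
      have h3 := ℓ.hasFDerivAt.comp (0 : E) (hasFDerivAt_derivOne (hr.contMDiff 1) hr.apply_one)
      rw [hp] at h3
      simpa [invariantPotential, hr.apply_one, Function.comp_def] using h3
    have h3 := (hasMFDerivAt_iff_hasFDerivAt.mp h1).fun_add h2
    simp only [sub_add_cancel] at h3
    exact h3.congr_fderiv (zero_add ℓ)

end IsHolomorphicRetract

end Integration

end ComplexNil

namespace ComplexNil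

/-! ### A simply connected nilpotent complex Lie group is an affine space -/

section AffineSpace

open Filter Topology

variable {E : Type*} [NormedAddCommGroup E] [NormedSpace ℂ E]
  {G : Type*} [TopologicalSpace G] [ChartedSpace E G] [Group G] [LieGroup 𝓘(ℂ, E) ω G]

namespace IsHolomorphicRetract

variable {K : Subgroup G} {r : G → G} {ℓ : E →L[ℂ] ℂ}

theorem hasMFDerivAt_coord_mul_zero (hr : IsHolomorphicRetract E K r) (h0 : derivOne E r = 0)
    {b : G} (hb : ContMDiffAt 𝓘(ℂ, E) 𝓘(ℂ, E) ω (coord E) b) :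
    HasMFDerivAt 𝓘(ℂ, E) 𝓘(ℂ, E) (fun h ↦ coord E (b * r h)) 1 0 := by
  have hΦ : ContMDiffAt 𝓘(ℂ, E) 𝓘(ℂ, E) ω (fun h : G ↦ coord E (b * h)) 1 :=
    ContMDiffAt.comp_of_eq hb (contMDiffAt_const.mul contMDiffAt_id) (mul_one b)
  have hc : ContinuousAt (fun v : E ↦ r (coordSymm G v)) 0 :=
    (hr.contMDiff.continuous.continuousAt).comp (contMDiffAt_coordSymm G).continuousAt
  have h1 := hasFDerivAt_comp_of_eq_one hΦ (a := fun v : E ↦ r (coordSymm G v)) (x := 0)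
    (by simp [hr.apply_one]) hc (hasFDerivAt_derivOne (hr.contMDiff 1) hr.apply_one)
  rw [h0, ContinuousLinearMap.comp_zero] at h1
  have h2 := hasMFDerivAt_zero_comp (T := coord E) (x := (1 : G))
    (f := fun v : E ↦ coord E (b * r (coordSymm G v)))
    (by rw [coord_one]; exact hasMFDerivAt_iff_hasFDerivAt.mpr h1)
    ((contMDiffAt_coord E).mdifferentiableAt (by simp))
  refine h2.congr_of_eventuallyEq ?_
  filter_upwards [eventually_coordSymm_coord E] with g hg
  simp [hg]

/-- A retract of dimension zero is trivial. -/
theorem eq_one_of_derivOne_eq_zero [PreconnectedSpace G] (hr : IsHolomorphicRetract E K r)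
    (h0 : derivOne E r = 0) (g : G) : r g = 1 := by
  have hlc : IsLocallyConstant r := by
    refine (IsLocallyConstant.iff_eventually_eq r).mpr fun x ↦ ?_
    have hT : ∀ x : G, ContMDiff 𝓘(ℂ, E) 𝓘(ℂ, E) ω (fun g ↦ (r x)⁻¹ * r g) := fun x ↦
      contMDiff_const.mul hr.contMDiff
    have hTx : Tendsto (fun g ↦ (r x)⁻¹ * r g) (𝓝 x) (𝓝 1) := by
      simpa using (hT x).continuous.tendsto x
    have h1 : ∀ᶠ g in 𝓝 x,
        HasMFDerivAt 𝓘(ℂ, E) 𝓘(ℂ, E) (fun g ↦ coord E ((r x)⁻¹ * r g)) g 0 := by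
      filter_upwards [hTx.eventually ((contMDiffAt_iff_contMDiffAt_nhds (by simp)).mp
        (contMDiffAt_coord (G := G) E))] with g hg
      have h2 := hasMFDerivAt_zero_comp (T := fun y ↦ (r g)⁻¹ * r y) (x := g)
        (f := fun h ↦ coord E ((r x)⁻¹ * r g * r h))
        (by rw [inv_mul_cancel]; exact hr.hasMFDerivAt_coord_mul_zero h0 hg)
        ((hT g).mdifferentiableAt (by simp))
      refine h2.congr_of_eventuallyEq (Eventually.of_forall fun y ↦ ?_)
      have h3 : r ((r g)⁻¹ * r y) = (r g)⁻¹ * r y :=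
        hr.apply_of_mem _ (K.mul_mem (K.inv_mem (hr.mem g)) (hr.mem y))
      simp only [h3]
      congr 1
      group
    filter_upwards [eventually_eq_of_hasMFDerivAt_zero h1,
      hTx.eventually (eventually_coordSymm_coord E)] with g h2 h3
    rw [h2] at h3
    simp only [inv_mul_cancel, coord_one, coordSymm_zero] at h3
    exact (inv_mul_eq_one.mp h3.symm).symm
  rw [hlc.apply_eq_of_preconnectedSpace g 1, hr.apply_one]

/-- A holomorphic homomorphism to `ℂ` with nonzero derivative has a section given by a one-parameter
subgroup. -/
theorem exists_section [CompleteSpace E] (hr : IsHolomorphicRetract E K r) (hℓ : ℓ ≠ 0)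
    {f : G → ℂ} (hf : Continuous f) (hf1 : f 1 = 0) (hfr : ∀ g, f (r g) = f g)
    (hfm : ∀ k ∈ K, ∀ g, f (k * r g) = f k + f g)
    (hfd : HasFDerivAt (fun v : E ↦ f (coordSymm G v)) ℓ 0) :
    ∃ σ : ℂ → G, ContMDiff 𝓘(ℂ, ℂ) 𝓘(ℂ, E) ω σ ∧ σ 0 = 1 ∧ (∀ t, σ t ∈ K) ∧ ∀ t, f (σ t) = t := by
  have : T2Space G := t2Space_of_lieGroup E
  obtain ⟨X, hX⟩ : ∃ X, ℓ X = 1 := by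
    obtain ⟨v, hv⟩ : ∃ v, ℓ v ≠ 0 := by
      by_contra! h
      exact hℓ (ContinuousLinearMap.ext h)
    exact ⟨(ℓ v)⁻¹ • v, by simp [hv]⟩
  have hline : ContMDiff 𝓘(ℂ, ℂ) 𝓘(ℂ, E) ω (fun t : ℂ ↦ t • X) :=
    (contDiff_id.smul contDiff_const).contMDiff
  have hc : ContMDiffAt 𝓘(ℂ, ℂ) 𝓘(ℂ, E) ω (fun t : ℂ ↦ r (coordSymm G (t • X))) 0 :=
    ContMDiffAt.comp 0 (hr.contMDiff _)
      (ContMDiffAt.comp_of_eq (g := coordSymm G) (contMDiffAt_coordSymm G) (hline 0)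
        (zero_smul ℂ X))
  obtain ⟨σ, hσ, hlim⟩ := exists_tendsto_pow_two_pow (by simp [hr.apply_one]) hc
  have hpow : ∀ k ∈ K, ∀ n : ℕ, f (k ^ n) = n * f k := by
    intro k hk n
    induction n with
    | zero => simp [hf1]
    | succ n ih =>
      have h := hfm (k ^ n) (K.pow_mem hk n) k
      rw [hr.apply_of_mem k hk, ih] at h
      rw [pow_succ, h]
      push_cast
      ring
  refine ⟨σ, hσ, ?_, fun t ↦ ?_, fun t ↦ ?_⟩
  · refine tendsto_nhds_unique (hlim 0) ?_
    simp [hr.apply_one]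
  · have hclosed : IsClosed {g : G | r g = g} := isClosed_eq hr.contMDiff.continuous continuous_id
    have h : σ t ∈ {g : G | r g = g} := hclosed.mem_of_tendsto (hlim t)
      (Eventually.of_forall fun n ↦ hr.apply_of_mem _ (K.pow_mem (hr.mem _) _))
    rw [← h]
    exact hr.mem _
  · have h1 := (hf.tendsto _).comp (hlim t)
    have h2 : Tendsto (fun n : ℕ ↦ ‖(2 : ℂ) ^ n‖) atTop atTop := by
      simpa using tendsto_pow_atTop_atTop_of_one_lt (one_lt_two (α := ℝ))
    have h3 := hfd.lim (t • X) h2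
    simp only [map_smul, hX, zero_add, coordSymm_zero, hf1, sub_zero, smul_eq_mul, mul_one] at h3
    refine tendsto_nhds_unique h1 (h3.congr fun n ↦ ?_)
    simp only [Function.comp_apply]
    rw [hpow _ (hr.mem _), hfr, smul_smul, div_eq_inv_mul]
    push_cast
    rfl

/-- Splitting off a one-parameter subgroup: the kernel of a homomorphism with a section is again a
holomorphic retract, of smaller dimension. -/
theorem exists_smaller_retract [FiniteDimensional ℂ E] (hr : IsHolomorphicRetract E K r)
    (hp : ℓ.comp (derivOne E r) = ℓ) (hℓ : ℓ ≠ 0)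
    {f : G → ℂ} (hf : ContMDiff 𝓘(ℂ, E) 𝓘(ℂ, ℂ) ω f) (hf1 : f 1 = 0) (hfr : ∀ g, f (r g) = f g)
    (hfm : ∀ k ∈ K, ∀ g, f (k * r g) = f k + f g)
    (hfd : HasFDerivAt (fun v : E ↦ f (coordSymm G v)) ℓ 0)
    {σ : ℂ → G} (hσ : ContMDiff 𝓘(ℂ, ℂ) 𝓘(ℂ, E) ω σ) (hσ0 : σ 0 = 1) (hσK : ∀ t, σ t ∈ K)
    (hfσ : ∀ t, f (σ t) = t) :
    ∃ K' : Subgroup G, (∀ k, k ∈ K' ↔ k ∈ K ∧ f k = 0) ∧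
      IsHolomorphicRetract E K' (fun g ↦ r g * (σ (f g))⁻¹) ∧
      Module.finrank ℂ (LinearMap.range (derivOne E (fun g ↦ r g * (σ (f g))⁻¹)).toLinearMap)
        < Module.finrank ℂ (LinearMap.range (derivOne E r).toLinearMap) := by
  have hmul : ∀ a ∈ K, ∀ b ∈ K, f (a * b) = f a + f b := by
    intro a ha b hb
    have h := hfm a ha b
    rwa [hr.apply_of_mem b hb] at h
  have hinv : ∀ a ∈ K, f a⁻¹ = -f a := by
    intro a ha
    have h := hmul a ha a⁻¹ (K.inv_mem ha)
    rw [mul_inv_cancel, hf1] at h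
    linear_combination -h
  let K' : Subgroup G :=
    { carrier := {k | k ∈ K ∧ f k = 0}
      one_mem' := ⟨K.one_mem, hf1⟩
      mul_mem' := fun {a b} ha hb ↦ ⟨K.mul_mem ha.1 hb.1, by
        rw [hmul a ha.1 b hb.1, ha.2, hb.2, add_zero]⟩
      inv_mem' := fun {a} ha ↦ ⟨K.inv_mem ha.1, by rw [hinv a ha.1, ha.2, neg_zero]⟩ }
  have hr' : IsHolomorphicRetract E K' (fun g ↦ r g * (σ (f g))⁻¹) :=
    { contMDiff := hr.contMDiff.mul (hσ.comp hf).inv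
      mem := fun g ↦ ⟨K.mul_mem (hr.mem g) (K.inv_mem (hσK _)), by
        rw [hmul _ (hr.mem g) _ (K.inv_mem (hσK _)), hinv _ (hσK _), hfr, hfσ, add_neg_cancel]⟩
      apply_of_mem := fun k hk ↦ by simp [hr.apply_of_mem k hk.1, hk.2, hσ0] }
  refine ⟨K', fun k ↦ Iff.rfl, hr', Submodule.finrank_lt_finrank_of_lt ?_⟩
  set r' : G → G := fun g ↦ r g * (σ (f g))⁻¹
  have h1 : (derivOne E r).comp (derivOne E r') = derivOne E r' := by
    rw [← derivOne_comp (hr.contMDiff 1) hr.apply_one (hr'.contMDiff 1) hr'.apply_one]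
    simp only [fun g ↦ hr.apply_of_mem (r' g) (hr'.mem g).1]
  have h2 : ℓ.comp (derivOne E r') = 0 := by
    have hc : ContinuousAt (fun v : E ↦ r' (coordSymm G v)) 0 :=
      (hr'.contMDiff.continuous.continuousAt).comp (contMDiffAt_coordSymm G).continuousAt
    have h3 := hasFDerivAt_comp_of_eq_one (hf 1) (a := fun v : E ↦ r' (coordSymm G v)) (x := 0)
      (by simp [hr'.apply_one]) hc (hasFDerivAt_derivOne (hr'.contMDiff 1) hr'.apply_one)
    rw [hfd.fderiv] at h3
    simp only [fun g ↦ (hr'.mem g).2] at h3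
    exact h3.unique (hasFDerivAt_const (0 : ℂ) (0 : E))
  refine lt_of_le_of_ne ?_ fun heq ↦ hℓ ?_
  · rintro _ ⟨v, rfl⟩
    exact ⟨derivOne E r' v, congrArg (fun L ↦ L v) h1⟩
  · ext v
    obtain ⟨w, hw⟩ : derivOne E r v ∈ LinearMap.range (derivOne E r').toLinearMap :=
      heq ▸ ⟨v, rfl⟩
    have h3 : ℓ (derivOne E r v) = ℓ v := congrArg (fun L ↦ L v) hp
    have h4 : ℓ (derivOne E r' w) = 0 := congrArg (fun L ↦ L w) h2
    have hw' : derivOne E r' w = derivOne E r v := hw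
    rw [← h3, ← hw', h4]
    rfl

/-- By induction on the dimension, a holomorphic retract of a simply connected nilpotent group is
biholomorphic to `ℂᵐ`: the coordinates are homomorphisms defined on a decreasing chain of
subgroups. -/
theorem exists_coordinates [FiniteDimensional ℂ E] [SimplyConnectedSpace G] [Group.IsNilpotent G]
    (d : ℕ) : ∀ (K : Subgroup G) (r : G → G), IsHolomorphicRetract E K r →
      Module.finrank ℂ (LinearMap.range (derivOne E r).toLinearMap) ≤ d →
      ∃ (m : ℕ) (Ψ : G → Fin m → ℂ) (S : (Fin m → ℂ) → G),
        ContMDiff 𝓘(ℂ, E) 𝓘(ℂ, Fin m → ℂ) ω Ψ ∧ ContMDiff 𝓘(ℂ, Fin m → ℂ) 𝓘(ℂ, E) ω S ∧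
        (∀ z, S z ∈ K) ∧ (∀ z, Ψ (S z) = z) ∧ ∀ g, S (Ψ g) = r g := by
  have : CompleteSpace E := FiniteDimensional.complete ℂ E
  induction d with
  | zero =>
    intro K r hr hd
    have h0 : derivOne E r = 0 := by
      have h1 := Submodule.finrank_eq_zero.mp (Nat.le_zero.mp hd)
      ext v
      have h2 : derivOne E r v ∈ LinearMap.range (derivOne E r).toLinearMap := ⟨v, rfl⟩
      rw [h1] at h2
      exact h2
    refine ⟨0, fun _ ↦ 0, fun _ ↦ 1, contMDiff_const, contMDiff_const, fun _ ↦ K.one_mem,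
      fun z ↦ Subsingleton.elim _ _, fun g ↦ (hr.eq_one_of_derivOne_eq_zero h0 g).symm⟩
  | succ d ih =>
    intro K r hr hd
    by_cases hne : derivOne E r = 0
    · refine ih K r hr ?_
      have h0 : LinearMap.range (derivOne E r).toLinearMap = ⊥ := by
        rw [hne]
        exact LinearMap.range_zero
      exact (Submodule.finrank_eq_zero.mpr h0).le.trans (Nat.zero_le d)
    obtain ⟨ℓ, hℓ, hp, hℓK⟩ := hr.exists_invariant_functional hne
    obtain ⟨f, hf, hf1, hfr, hfm, hfd⟩ := hr.exists_homomorphism hp hℓK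
    obtain ⟨σ, hσ, hσ0, hσK, hfσ⟩ := hr.exists_section hℓ hf.continuous hf1 hfr hfm hfd
    obtain ⟨K', hK', hr', hlt⟩ := hr.exists_smaller_retract hp hℓ hf hf1 hfr hfm hfd hσ hσ0 hσK hfσ
    obtain ⟨m, Ψ, S, hΨ, hS, hSK, hΨS, hSΨ⟩ := ih K' _ hr' (by omega)
    refine ⟨m + 1, fun g ↦ Fin.cons (f g) (Ψ (r g * (σ (f g))⁻¹)),
      fun z ↦ S (Fin.tail z) * σ (z 0), ?_, ?_, fun z ↦ ?_, fun z ↦ ?_, fun g ↦ ?_⟩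
    · rw [contMDiff_pi_space]
      intro i
      refine Fin.cases ?_ (fun j ↦ ?_) i
      · simpa using hf
      · simpa using contMDiff_pi_space.mp (hΨ.comp hr'.contMDiff) j
    · refine ContMDiff.mul (hS.comp ?_) (hσ.comp ?_)
      · rw [contMDiff_iff_contDiff, contDiff_pi]
        exact fun j ↦ contDiff_apply ℂ ℂ j.succ
      · rw [contMDiff_iff_contDiff]
        exact contDiff_apply ℂ ℂ 0
    · exact K.mul_mem ((hK' _).mp (hSK _)).1 (hσK _)
    · have h1 : f (S (Fin.tail z) * σ (z 0)) = z 0 := by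
        have h2 := hfm _ ((hK' _).mp (hSK (Fin.tail z))).1 (σ (z 0))
        rwa [hr.apply_of_mem _ (hσK _), ((hK' _).mp (hSK (Fin.tail z))).2, hfσ, zero_add] at h2
      have h2 : r (S (Fin.tail z) * σ (z 0)) = S (Fin.tail z) * σ (z 0) :=
        hr.apply_of_mem _ (K.mul_mem ((hK' _).mp (hSK _)).1 (hσK _))
      simp only [h1, h2, mul_inv_cancel_right, hΨS, Fin.cons_self_tail]
    · have h1 : f (r g * (σ (f g))⁻¹) = 0 := ((hK' _).mp (hr'.mem g)).2
      have h2 := hSΨ (r g * (σ (f g))⁻¹)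
      simp only [h1, hσ0, inv_one, mul_one,
        hr.apply_of_mem _ ((hK' _).mp (hr'.mem g)).1] at h2
      simp [Fin.tail_cons, h2]

end IsHolomorphicRetract

variable (E G) in
theorem nonempty_diffeomorph_pi [FiniteDimensional ℂ E] [SimplyConnectedSpace G]
    [Group.IsNilpotent G] :
    Nonempty (G ≃ₘ^ω⟮𝓘(ℂ, E), 𝓘(ℂ, Fin (Module.finrank ℂ E) → ℂ)⟯
      (Fin (Module.finrank ℂ E) → ℂ)) := by
  have hr : IsHolomorphicRetract E (⊤ : Subgroup G) id :=
    ⟨contMDiff_id, fun _ ↦ Subgroup.mem_top _, fun _ _ ↦ rfl⟩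
  obtain ⟨m, Ψ, S, hΨ, hS, -, hΨS, hSΨ⟩ :=
    IsHolomorphicRetract.exists_coordinates _ ⊤ id hr le_rfl
  let Φ : G ≃ₘ^ω⟮𝓘(ℂ, E), 𝓘(ℂ, Fin m → ℂ)⟯ (Fin m → ℂ) :=
    { toFun := Ψ, invFun := S, left_inv := hSΨ, right_inv := hΨS
      contMDiff_toFun := hΨ, contMDiff_invFun := hS }
  -- the derivative of the biholomorphic map at a point identifies the dimensions
  have hm : Module.finrank ℂ E = m := by
    have e : E ≃L[ℂ] (Fin m → ℂ) := Φ.mfderivToContinuousLinearEquiv (by simp) 1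
    simpa using e.toLinearEquiv.finrank_eq
  rw [hm]
  exact ⟨Φ⟩

end AffineSpace

end ComplexNil

namespace ComplexNil

/-! ### The quotient by a discrete subgroup and its tangent bundle -/

section QuotientManifold

open Filter Topology

variable {E : Type*} [NormedAddCommGroup E] [NormedSpace ℂ E]
  {G : Type*} [TopologicalSpace G] [ChartedSpace E G] [Group G] [LieGroup 𝓘(ℂ, E) ω G]

variable (E) in
/-- Right translation as a biholomorphic map. -/
def mulRightDiffeomorph (γ : G) : G ≃ₘ^ω⟮𝓘(ℂ, E), 𝓘(ℂ, E)⟯ G where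
  toEquiv := Equiv.mulRight γ
  contMDiff_toFun := contMDiff_mul_right
  contMDiff_invFun := contMDiff_mul_right

theorem snd_trivializationAt_of_proj_eq {p : TangentBundle 𝓘(ℂ, E) G} {b : G} (h : p.proj = b) :
    (trivializationAt E (TangentSpace 𝓘(ℂ, E)) b p).2 = p.2 := by
  subst h
  exact congrArg Prod.snd ((tangentBundleCore 𝓘(ℂ, E) G).localTrivAt_apply_mk p.proj p.2)

variable (Γ : Subgroup G) [DiscreteTopology Γ]

variable (E) in
theorem exists_chartAt_quotient_eq (x : G ⧸ Γ) :
    ∃ a : G, (a : G ⧸ Γ) = x ∧ chartAt E x =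
      ((isLocalHomeomorph_mk E Γ).localInverseAt a).trans (chartAt E a) :=
  ⟨_, (QuotientGroup.mk_surjective (s := Γ)).hasRightInverse.choose_spec x, rfl⟩

variable (E) in
theorem isLocalDiffeomorph_mk :
    IsLocalDiffeomorph 𝓘(ℂ, E) 𝓘(ℂ, E) ω (QuotientGroup.mk : G → G ⧸ Γ) := by
  intro g
  obtain ⟨a, ha, hchart⟩ := exists_chartAt_quotient_eq E Γ (g : G ⧸ Γ)
  have hf := isLocalHomeomorph_mk E Γ
  -- at the representative `a` used by the atlas, the projection is the identity in charts
  have hloc : IsLocalDiffeomorphAt 𝓘(ℂ, E) 𝓘(ℂ, E) ω (QuotientGroup.mk : G → G ⧸ Γ) a := by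
    have hsm : ContMDiffOn 𝓘(ℂ, E) 𝓘(ℂ, E) ω (chartAt E (g : G ⧸ Γ)).symm
          (chartAt E (g : G ⧸ Γ)).target ∧
        ContMDiffOn 𝓘(ℂ, E) 𝓘(ℂ, E) ω (chartAt E (g : G ⧸ Γ)) (chartAt E (g : G ⧸ Γ)).source :=
      ⟨contMDiffOn_chart_symm, contMDiffOn_chart⟩
    generalize chartAt E (g : G ⧸ Γ) = e at hchart hsm
    refine ⟨{ toPartialEquiv := ((chartAt E a).trans e.symm).toPartialEquiv
              open_source := ((chartAt E a).trans e.symm).open_source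
              open_target := ((chartAt E a).trans e.symm).open_target
              contMDiffOn_toFun := ?_
              contMDiffOn_invFun := ?_ }, ?_, ?_⟩
    · exact hsm.1.comp ((contMDiffOn_chart (I := 𝓘(ℂ, E)) (n := ω)).mono fun z hz ↦ hz.1)
        fun z hz ↦ hz.2
    · exact (contMDiffOn_chart_symm (I := 𝓘(ℂ, E)) (n := ω)).comp (hsm.2.mono fun z hz ↦ hz.1)
        fun z hz ↦ hz.2
    · refine ⟨mem_chart_source E a, ?_⟩
      show chartAt E a a ∈ e.target
      rw [hchart]
      refine ⟨mem_chart_target E a, ?_⟩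
      show (chartAt E a).symm (chartAt E a a) ∈ (hf.localInverseAt a).target
      rw [(chartAt E a).left_inv (mem_chart_source E a)]
      exact hf.self_mem_localInverseAt_target
    · intro z hz
      show (z : G ⧸ Γ) = e.symm (chartAt E a z)
      rw [hchart]
      show (z : G ⧸ Γ) = (hf.localInverseAt a).symm ((chartAt E a).symm (chartAt E a z))
      rw [(chartAt E a).left_inv hz.1, hf.localInverseAt_symm]
  have hγ : (a⁻¹ * g) ∈ Γ := QuotientGroup.eq.mp ha
  have h1 : IsLocalDiffeomorphAt 𝓘(ℂ, E) 𝓘(ℂ, E) ω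
      (mulRightDiffeomorph E (a⁻¹ * g)⁻¹ : G → G) g :=
    (mulRightDiffeomorph E (a⁻¹ * g)⁻¹).isLocalDiffeomorph g
  have h2 : mulRightDiffeomorph E (a⁻¹ * g)⁻¹ g = a := by
    show g * (a⁻¹ * g)⁻¹ = a
    group
  rw [← h2] at hloc
  have h3 := h1.comp (g := (QuotientGroup.mk : G → G ⧸ Γ)) (K := 𝓘(ℂ, E)) _ hloc
  have h4 : (QuotientGroup.mk : G → G ⧸ Γ) ∘ mulRightDiffeomorph E (a⁻¹ * g)⁻¹
      = QuotientGroup.mk := by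
    funext z
    exact (QuotientGroup.mk_mul_of_mem z (Γ.inv_mem hγ))
  rwa [h4] at h3

/-- Near every point the projection has holomorphic sections. -/
theorem exists_section_mk (x : G ⧸ Γ) : ∃ (U : Set (G ⧸ Γ)) (s : G ⧸ Γ → G), IsOpen U ∧ x ∈ U ∧
    ContMDiffOn 𝓘(ℂ, E) 𝓘(ℂ, E) ω s U ∧ ∀ y ∈ U, (s y : G ⧸ Γ) = y := by
  obtain ⟨g, rfl⟩ := QuotientGroup.mk_surjective x
  have h := isLocalDiffeomorph_mk E Γ g
  exact ⟨_, h.localInverse, h.localInverse_open_source, h.localInverse_mem_source,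
    h.localInverse_contMDiffOn, fun y hy ↦ h.localInverse_right_inv hy⟩

theorem contMDiff_smul_quotient : ContMDiff (𝓘(ℂ, E).prod 𝓘(ℂ, E)) 𝓘(ℂ, E) ω
    (fun p : G × (G ⧸ Γ) ↦ p.1 • p.2) := by
  intro p
  obtain ⟨U, s, hU, hxU, hs, hπs⟩ := exists_section_mk (E := E) Γ p.2
  have h1 : ContMDiffAt (𝓘(ℂ, E).prod 𝓘(ℂ, E)) 𝓘(ℂ, E) ω
      (fun p : G × (G ⧸ Γ) ↦ ((p.1 * s p.2 : G) : G ⧸ Γ)) p := by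
    refine ((isLocalDiffeomorph_mk E Γ).contMDiff _).comp p (contMDiffAt_fst.mul ?_)
    exact (hs.contMDiffAt (hU.mem_nhds hxU)).comp p contMDiffAt_snd
  refine h1.congr_of_eventuallyEq ?_
  filter_upwards [continuous_snd.continuousAt.eventually (hU.mem_nhds hxU)] with q hq
  nth_rw 1 [← hπs _ hq]
  rfl

variable (E) in
/-- The value at `x` of the vector fields on `G ⧸ Γ` generated by the left action of `G`, as a
function of the tangent vector of `G` at the identity. -/
noncomputable def orbitDeriv (x : G ⧸ Γ) : E →L[ℂ] E :=
  mfderiv 𝓘(ℂ, E) 𝓘(ℂ, E) (fun h : G ↦ h • x) 1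

variable (E) in
theorem contMDiff_orbitDeriv : ContMDiff (𝓘(ℂ, E).prod 𝓘(ℂ, E)) 𝓘(ℂ, E).tangent ω
    (fun p : (G ⧸ Γ) × E ↦ (⟨p.1, orbitDeriv E Γ p.1 p.2⟩ : TangentBundle 𝓘(ℂ, E) (G ⧸ Γ))) := by
  have hG : ContMDiff 𝓘(ℂ, E) 𝓘(ℂ, E).tangent ω
      (fun v : E ↦ (⟨1, v⟩ : TangentBundle 𝓘(ℂ, E) G)) := by
    intro v
    rw [Bundle.contMDiffAt_totalSpace]
    refine ⟨contMDiffAt_const, ?_⟩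
    refine contMDiffAt_id.congr_of_eventuallyEq (Eventually.of_forall fun w ↦ ?_)
    exact snd_trivializationAt_of_proj_eq rfl
  have hX : ContMDiff 𝓘(ℂ, E) 𝓘(ℂ, E).tangent ω
      (fun x : G ⧸ Γ ↦ (⟨x, 0⟩ : TangentBundle 𝓘(ℂ, E) (G ⧸ Γ))) :=
    Bundle.contMDiff_zeroSection _ _
  have h := ((contMDiff_smul_quotient (E := E) Γ).contMDiff_tangentMap (m := ω) le_top).comp
    (contMDiff_equivTangentBundleProd_symm.comp
      ((hG.comp contMDiff_snd).prodMk (hX.comp contMDiff_fst)))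
  refine h.congr fun p ↦ Bundle.TotalSpace.ext (one_smul G p.1).symm (heq_of_eq ?_)
  show orbitDeriv E Γ p.1 p.2 = mfderiv (𝓘(ℂ, E).prod 𝓘(ℂ, E)) 𝓘(ℂ, E)
    (fun q : G × (G ⧸ Γ) ↦ q.1 • q.2) (1, p.1) (p.2, 0)
  refine Eq.symm ((mfderiv_prod_eq_add_apply (v := (p.2, 0))
    ((contMDiff_smul_quotient (E := E) Γ).mdifferentiableAt (by simp))).trans ?_)
  exact (congrArg (orbitDeriv E Γ p.1 p.2 + ·) (map_zero _)).trans (add_zero _)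

variable (E) in
/-- The derivative of a local section of the projection, translated to the identity, inverts
`orbitDeriv`. -/
theorem orbitDeriv_comp_mfderiv_section {U : Set (G ⧸ Γ)} {s : G ⧸ Γ → G} (hU : IsOpen U)
    (hπs : ∀ y ∈ U, (s y : G ⧸ Γ) = y) {y : G ⧸ Γ}
    (hy : y ∈ U) {M : E →L[ℂ] E}
    (hM : HasMFDerivAt 𝓘(ℂ, E) 𝓘(ℂ, E) (fun z ↦ s z * (s y)⁻¹) y M) :
    (orbitDeriv E Γ y).comp M = ContinuousLinearMap.id ℂ E := by
  have h1 : HasMFDerivAt 𝓘(ℂ, E) 𝓘(ℂ, E) (fun h : G ↦ h • y) (s y * (s y)⁻¹)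
      (orbitDeriv E Γ y) := by
    rw [mul_inv_cancel]
    have h2 : ContMDiff 𝓘(ℂ, E) 𝓘(ℂ, E) ω (fun h : G ↦ h • y) :=
      (contMDiff_smul_quotient (E := E) Γ).comp (contMDiff_id.prodMk contMDiff_const)
    exact (h2.mdifferentiableAt (by simp)).hasMFDerivAt
  have h3 : HasMFDerivAt 𝓘(ℂ, E) 𝓘(ℂ, E) (fun z : G ⧸ Γ ↦ z) y ((orbitDeriv E Γ y).comp M) := by
    refine (h1.comp y hM).congr_of_eventuallyEq ?_
    filter_upwards [hU.mem_nhds hy] with z hz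
    have h4 : (s z * (s y)⁻¹) • (s y : G ⧸ Γ) = (s z : G ⧸ Γ) := by
      rw [MulAction.Quotient.smul_mk, smul_eq_mul, inv_mul_cancel_right]
    rw [hπs y hy, hπs z hz] at h4
    exact h4.symm
  exact hasMFDerivAt_unique h3 (hasMFDerivAt_id y)

variable (E) in
/-- In terms of a local section of the projection, the inverses of the maps `orbitDeriv` depend
holomorphically on the point. -/
theorem exists_contMDiffOn_inverse_orbitDeriv {U : Set (G ⧸ Γ)} {s : G ⧸ Γ → G} (hU : IsOpen U)
    (hs : ContMDiffOn 𝓘(ℂ, E) 𝓘(ℂ, E) ω s U) (hπs : ∀ y ∈ U, (s y : G ⧸ Γ) = y) :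
    ∃ M : G ⧸ Γ → E →L[ℂ] E,
      (∀ y ∈ U, (orbitDeriv E Γ y).comp (M y) = ContinuousLinearMap.id ℂ E) ∧
      ∀ w : TangentBundle 𝓘(ℂ, E) (G ⧸ Γ), w.proj ∈ U →
        ContMDiffAt 𝓘(ℂ, E).tangent 𝓘(ℂ, E) ω
          (fun w : TangentBundle 𝓘(ℂ, E) (G ⧸ Γ) ↦ M w.proj w.2) w := by
  set k : (G ⧸ Γ) × G → G := fun p ↦ s p.1 * p.2 with hk
  have hV : IsOpen (U ×ˢ (Set.univ : Set G)) := hU.prod isOpen_univ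
  have hks : ContMDiffOn (𝓘(ℂ, E).prod 𝓘(ℂ, E)) 𝓘(ℂ, E) ω k (U ×ˢ Set.univ) :=
    (hs.comp contMDiffOn_fst fun p hp ↦ hp.1).mul contMDiffOn_snd
  have hM : ∀ y ∈ U, HasMFDerivAt 𝓘(ℂ, E) 𝓘(ℂ, E) (fun z ↦ s z * (s y)⁻¹) y
      (mfderiv 𝓘(ℂ, E) 𝓘(ℂ, E) (fun z ↦ s z * (s y)⁻¹) y) := fun y hy ↦
    (((hs.contMDiffAt (hU.mem_nhds hy)).mul contMDiffAt_const).mdifferentiableAt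
      (by simp)).hasMFDerivAt
  refine ⟨fun y ↦ mfderiv 𝓘(ℂ, E) 𝓘(ℂ, E) (fun z ↦ s z * (s y)⁻¹) y, fun y hy ↦
    orbitDeriv_comp_mfderiv_section E Γ hU hπs hy (hM y hy), fun w hw ↦ ?_⟩
  have hproj : ContMDiff 𝓘(ℂ, E).tangent 𝓘(ℂ, E) ω
      (fun w : TangentBundle 𝓘(ℂ, E) (G ⧸ Γ) ↦ w.proj) :=
    Bundle.contMDiff_proj _
  have hopen : IsOpen {w : TangentBundle 𝓘(ℂ, E) (G ⧸ Γ) | w.proj ∈ U} :=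
    hU.preimage hproj.continuous
  have hzero : ContMDiff 𝓘(ℂ, E) 𝓘(ℂ, E).tangent ω
      (fun g : G ↦ (⟨g, 0⟩ : TangentBundle 𝓘(ℂ, E) G)) := Bundle.contMDiff_zeroSection _ _
  have hinner : ContMDiffAt 𝓘(ℂ, E).tangent (𝓘(ℂ, E).prod 𝓘(ℂ, E)).tangent ω
      (fun w : TangentBundle 𝓘(ℂ, E) (G ⧸ Γ) ↦
        (equivTangentBundleProd 𝓘(ℂ, E) (G ⧸ Γ) 𝓘(ℂ, E) G).symm (w, ⟨(s w.proj)⁻¹, 0⟩)) w := by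
    refine (contMDiff_equivTangentBundleProd_symm _).comp w (contMDiffAt_id.prodMk ?_)
    refine (hzero _).comp w ?_
    exact ((hs.contMDiffAt (hU.mem_nhds hw)).comp w (hproj w)).inv
  have hF := ((hks.contMDiffOn_tangentMapWithin (m := ω) le_top hV.uniqueMDiffOn).contMDiffAt
    (x := (equivTangentBundleProd 𝓘(ℂ, E) (G ⧸ Γ) 𝓘(ℂ, E) G).symm (w, ⟨(s w.proj)⁻¹, 0⟩))
    ((hV.preimage (FiberBundle.continuous_proj _ _)).mem_nhds ⟨hw, trivial⟩)).comp w hinner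
  have hF2 := (Bundle.contMDiffAt_totalSpace.mp hF).2
  refine hF2.congr_of_eventuallyEq ?_
  filter_upwards [hopen.mem_nhds hw] with w' hw'
  have hd : mfderivWithin (𝓘(ℂ, E).prod 𝓘(ℂ, E)) 𝓘(ℂ, E) k (U ×ˢ Set.univ)
      (w'.proj, (s w'.proj)⁻¹) (w'.2, 0)
        = mfderiv 𝓘(ℂ, E) 𝓘(ℂ, E) (fun z ↦ s z * (s w'.proj)⁻¹) w'.proj w'.2 := by
    have hkat : MDifferentiableAt (𝓘(ℂ, E).prod 𝓘(ℂ, E)) 𝓘(ℂ, E) k (w'.proj, (s w'.proj)⁻¹) :=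
      (hks.contMDiffAt (hV.mem_nhds ⟨hw', trivial⟩)).mdifferentiableAt (by simp)
    rw [mfderivWithin_of_isOpen hV ⟨hw', trivial⟩]
    refine (mfderiv_prod_eq_add_apply (v := ((w'.2, 0) : E × E)) hkat).trans ?_
    exact (congrArg (_ + ·) (map_zero _)).trans (add_zero _)
  have hone : s w'.proj * (s w'.proj)⁻¹ = s w.proj * (s w.proj)⁻¹ := by simp
  have hsnd := snd_trivializationAt_of_proj_eq (E := E) (b := s w.proj * (s w.proj)⁻¹)
    (p := tangentMapWithin (𝓘(ℂ, E).prod 𝓘(ℂ, E)) 𝓘(ℂ, E) k (U ×ˢ Set.univ)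
      ((equivTangentBundleProd 𝓘(ℂ, E) (G ⧸ Γ) 𝓘(ℂ, E) G).symm (w', ⟨(s w'.proj)⁻¹, 0⟩))) hone
  exact (hsnd.trans hd).symm

variable (E) in
theorem tangentBundleIsTrivial_quotient [FiniteDimensional ℂ E] :
    TangentBundleIsTrivial E (G ⧸ Γ) := by
  have hinv : ∀ {y : G ⧸ Γ} {M : E →L[ℂ] E},
      (orbitDeriv E Γ y).comp M = ContinuousLinearMap.id ℂ E →
      M.comp (orbitDeriv E Γ y) = ContinuousLinearMap.id ℂ E := by
    intro y M h
    have h1 : ((orbitDeriv E Γ y).toLinearMap * M.toLinearMap : Module.End ℂ E) = 1 :=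
      congrArg ContinuousLinearMap.toLinearMap h
    have h2 := mul_eq_one_comm.mp h1
    ext v
    exact LinearMap.congr_fun h2 v
  have hM : ∀ {U : Set (G ⧸ Γ)} {M : G ⧸ Γ → E →L[ℂ] E},
      (∀ y ∈ U, (orbitDeriv E Γ y).comp (M y) = ContinuousLinearMap.id ℂ E) →
      ∀ y ∈ U, (orbitDeriv E Γ y).inverse = M y := fun h y hy ↦
    ContinuousLinearMap.inverse_eq (h y hy) (hinv (h y hy))
  have hex : ∀ y, ∃ M : E →L[ℂ] E, (orbitDeriv E Γ y).inverse = M ∧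
      (orbitDeriv E Γ y).comp M = ContinuousLinearMap.id ℂ E := by
    intro y
    obtain ⟨U, s, hU, hyU, hs, hπs⟩ := exists_section_mk (E := E) Γ y
    obtain ⟨M, h1, -⟩ := exists_contMDiffOn_inverse_orbitDeriv E Γ hU hs hπs
    exact ⟨M y, hM h1 y hyU, h1 y hyU⟩
  refine ⟨{ toFun := fun w ↦ (w.proj, (orbitDeriv E Γ w.proj).inverse w.2)
            invFun := fun p ↦ ⟨p.1, orbitDeriv E Γ p.1 p.2⟩
            left_inv := fun w ↦ ?_
            right_inv := fun p ↦ ?_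
            contMDiff_toFun := fun w ↦ ?_
            contMDiff_invFun := contMDiff_orbitDeriv E Γ }, fun w ↦ rfl, fun x ↦ ?_⟩
  · obtain ⟨M, h1, h2⟩ := hex w.proj
    refine Bundle.TotalSpace.ext rfl (heq_of_eq ?_)
    show orbitDeriv E Γ w.proj ((orbitDeriv E Γ w.proj).inverse w.2) = w.2
    rw [h1]
    exact congrArg (fun L ↦ L w.2) h2
  · obtain ⟨M, h1, h2⟩ := hex p.1
    refine Prod.ext rfl ?_
    show (orbitDeriv E Γ p.1).inverse (orbitDeriv E Γ p.1 p.2) = p.2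
    rw [h1]
    exact congrArg (fun L ↦ L p.2) (hinv h2)
  · obtain ⟨U, s, hU, hwU, hs, hπs⟩ := exists_section_mk (E := E) Γ w.proj
    obtain ⟨M, h1, h2⟩ := exists_contMDiffOn_inverse_orbitDeriv E Γ hU hs hπs
    have hproj : ContMDiff 𝓘(ℂ, E).tangent 𝓘(ℂ, E) ω
        (fun w : TangentBundle 𝓘(ℂ, E) (G ⧸ Γ) ↦ w.proj) :=
      Bundle.contMDiff_proj _
    refine (hproj w).prodMk ((h2 w hwU).congr_of_eventuallyEq ?_)
    filter_upwards [(hU.preimage hproj.continuous).mem_nhds hwU] with w' hw'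
    rw [hM h1 _ hw']
  · exact (orbitDeriv E Γ x).inverse.toLinearMap.isLinear

end QuotientManifold

end ComplexNil

namespace ComplexNil

/-! ### Diagonal actions and compact quotients -/

section DiagonalActions

open Filter Topology

variable {E : Type*} [NormedAddCommGroup E] [NormedSpace ℂ E]
  {G : Type*} [TopologicalSpace G] [ChartedSpace E G] [Group G] [LieGroup 𝓘(ℂ, E) ω G]

/-- A nilpotent group of deck transformations acting diagonally on `ℂⁿ` is commutative: on each
factor it acts by affine maps. -/
theorem commute_of_actsDiagonally {n : ℕ} [Group.IsNilpotent G] (Γ : Subgroup G)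
    (φ : G ≃ₘ^ω⟮𝓘(ℂ, E), 𝓘(ℂ, Fin n → ℂ)⟯ (Fin n → ℂ))
    (h : ActsDiagonally (transportedDeckAction Γ φ.toEquiv)) (a b : Γ) : a * b = b * a := by
  obtain ⟨ρ, hρ⟩ : ∃ ρ : Fin n → Γ →* Equiv.Perm ℂ, ∀ k u i,
      transportedDeckAction Γ φ.toEquiv k u i = ρ i k (u i) := h
  have happly : ∀ (k : Γ) (u : Fin n → ℂ),
      transportedDeckAction Γ φ.toEquiv k u = φ (φ.symm u * (k : G)⁻¹) := fun _ _ ↦ rfl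
  have hdiff : ∀ i k, Differentiable ℂ (ρ i k) := by
    intro i k
    have h1 : ContMDiff 𝓘(ℂ, ℂ) 𝓘(ℂ, Fin n → ℂ) ω (Function.update (0 : Fin n → ℂ) i) := by
      rw [contMDiff_iff_contDiff]
      exact contDiff_update ω 0 i
    have h2 : ContMDiff 𝓘(ℂ, ℂ) 𝓘(ℂ, Fin n → ℂ) ω
        (fun w : ℂ ↦ φ (φ.symm (Function.update (0 : Fin n → ℂ) i w) * (k : G)⁻¹)) :=
      φ.contMDiff.comp ((φ.symm.contMDiff.comp h1).mul contMDiff_const)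
    have h3 := (contMDiff_pi_space.mp h2 i).contDiff.differentiable (by simp)
    have h4 : (fun w : ℂ ↦ φ (φ.symm (Function.update (0 : Fin n → ℂ) i w) * (k : G)⁻¹) i)
        = ρ i k := by
      funext w
      rw [← happly, hρ, Function.update_self]
    rwa [h4] at h3
  have haffine : ∀ i k, ∃ m t, m ≠ 0 ∧ ∀ z, ρ i k z = m * z + t := by
    intro i k
    have hsymm : ((ρ i k).symm : ℂ → ℂ) = ρ i k⁻¹ := by
      rw [map_inv]
      rfl
    have hc : Continuous (ρ i k).symm := by
      rw [hsymm]
      exact (hdiff i k⁻¹).continuous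
    obtain ⟨m, t, hm, hmt⟩ := exists_eq_affine_of_mem_AutC
      (f := { toEquiv := ρ i k, continuous_toFun := (hdiff i k).continuous,
              continuous_invFun := hc })
      ⟨hdiff i k, by show Differentiable ℂ (ρ i k).symm; rw [hsymm]; exact hdiff i k⁻¹⟩
    exact ⟨m, t, hm, hmt⟩
  have h1 : transportedDeckAction Γ φ.toEquiv (a * b)
      = transportedDeckAction Γ φ.toEquiv (b * a) := by
    ext u i
    rw [hρ, hρ, map_mul, map_mul, commute_of_affine_action (ρ i) (haffine i) a b]
  have h2 := congrArg (fun e ↦ e (φ 1)) h1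
  simp only [happly, φ.symm_apply_apply, one_mul] at h2
  exact Subtype.ext (inv_injective (φ.injective h2))

/-- A holomorphic map on `G` which is invariant under a cocompact discrete subgroup is constant, if
`G` is biholomorphic to `ℂⁿ`: it descends to the compact quotient. -/
theorem eq_of_forall_mul_mem [PreconnectedSpace G] {n : ℕ}
    (φ : G ≃ₘ^ω⟮𝓘(ℂ, E), 𝓘(ℂ, Fin n → ℂ)⟯ (Fin n → ℂ)) (Γ : Subgroup G) [DiscreteTopology Γ]
    [CompactSpace (G ⧸ Γ)] {F : G → G} (hF : ContMDiff 𝓘(ℂ, E) 𝓘(ℂ, E) ω F)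
    (hFΓ : ∀ g, ∀ γ ∈ Γ, F (g * γ) = F g) (a b : G) : F a = F b := by
  have : PreconnectedSpace (G ⧸ Γ) :=
    QuotientGroup.mk_surjective.denseRange.preconnectedSpace QuotientGroup.continuous_mk
  let f : G ⧸ Γ → (Fin n → ℂ) := fun x ↦ φ (F x.out)
  have hf : ∀ g : G, f g = φ (F g) := by
    intro g
    obtain ⟨γ, hγ⟩ := QuotientGroup.mk_out_eq_mul Γ g
    simp only [f, hγ, hFΓ g γ γ.2]
  have hfd : MDifferentiable 𝓘(ℂ, E) 𝓘(ℂ, Fin n → ℂ) f := by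
    intro x
    obtain ⟨U, s, hU, hxU, hs, hπs⟩ := exists_section_mk (E := E) Γ x
    have h1 : ContMDiffAt 𝓘(ℂ, E) 𝓘(ℂ, Fin n → ℂ) ω (fun y ↦ φ (F (s y))) x :=
      ((φ.contMDiff.comp hF) _).comp x (hs.contMDiffAt (hU.mem_nhds hxU))
    refine (h1.congr_of_eventuallyEq ?_).mdifferentiableAt (by simp)
    filter_upwards [hU.mem_nhds hxU] with y hy
    rw [← hf, hπs y hy]
  have : IsManifold 𝓘(ℂ, E) 1 (G ⧸ Γ) := IsManifold.of_le (n := ω) le_top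
  have h := hfd.apply_eq_of_compactSpace (a : G ⧸ Γ) (b : G ⧸ Γ)
  rw [hf, hf] at h
  exact φ.injective h

/-- If a group biholomorphic to `ℂⁿ` has a commutative cocompact discrete subgroup `Γ`, it is
commutative: `Γ` is central because conjugates of its elements are `Γ`-invariant functions, and then
commutators are `Γ`-invariant functions. -/
theorem commute_of_commute_discrete_subgroup [PreconnectedSpace G] {n : ℕ}
    (φ : G ≃ₘ^ω⟮𝓘(ℂ, E), 𝓘(ℂ, Fin n → ℂ)⟯ (Fin n → ℂ)) (Γ : Subgroup G) [DiscreteTopology Γ]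
    [CompactSpace (G ⧸ Γ)] (hΓ : ∀ a b : Γ, a * b = b * a) (a b : G) : a * b = b * a := by
  have hcentral : ∀ γ ∈ Γ, ∀ g : G, g * γ = γ * g := by
    intro γ hγ g
    have h := eq_of_forall_mul_mem φ Γ (F := fun g ↦ g * γ * g⁻¹)
      ((contMDiff_id.mul contMDiff_const).mul contMDiff_id.inv) (fun g δ hδ ↦ by
        have h1 : δ * γ = γ * δ := congrArg Subtype.val (hΓ ⟨δ, hδ⟩ ⟨γ, hγ⟩)
        simp only [mul_assoc, mul_inv_rev]
        rw [← mul_assoc δ γ, h1]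
        group) g 1
    simp only [one_mul, inv_one, mul_one] at h
    exact mul_inv_eq_iff_eq_mul.mp h
  have h := eq_of_forall_mul_mem φ Γ (F := fun h ↦ a * h * a⁻¹ * h⁻¹)
    (((contMDiff_const.mul contMDiff_id).mul contMDiff_const).mul contMDiff_id.inv)
    (fun h γ hγ ↦ by
      simp only [mul_assoc, mul_inv_rev]
      rw [← mul_assoc γ a⁻¹, ← hcentral γ hγ a⁻¹]
      group) b 1
  simp only [mul_one, mul_inv_cancel, inv_one] at h
  exact mul_inv_eq_iff_eq_mul.mp (mul_inv_eq_one.mp h)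

end DiagonalActions

end ComplexNil

theorem mainTheorem6
    {E : Type*} [NormedAddCommGroup E] [NormedSpace ℂ E] [FiniteDimensional ℂ E]
    {G : Type*} [TopologicalSpace G] [ChartedSpace E G] [Group G] [LieGroup 𝓘(ℂ, E) ω G]
    [SimplyConnectedSpace G] [Group.IsNilpotent G] (hG : ¬ ∀ a b : G, a * b = b * a)
    (Γ : Subgroup G) [DiscreteTopology Γ] [CompactSpace (G ⧸ Γ)] :
    -- `G` is the universal covering of the complex manifold `X = G ⧸ Γ`, with deck group `Γ`
    (IsQuotientCoveringMap (QuotientGroup.mk : G → G ⧸ Γ) Γ.op ∧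
      IsLocalDiffeomorph 𝓘(ℂ, E) 𝓘(ℂ, E) ω (QuotientGroup.mk : G → G ⧸ Γ)) ∧
    -- `T_X` is trivial
    ComplexNil.TangentBundleIsTrivial E (G ⧸ Γ) ∧
    -- `G` is isomorphic to `ℂⁿ`
    Nonempty (G ≃ₘ^ω⟮𝓘(ℂ, E), 𝓘(ℂ, Fin (Module.finrank ℂ E) → ℂ)⟯
      (Fin (Module.finrank ℂ E) → ℂ)) ∧
    -- whatever isomorphism is chosen, `Γ` does not act diagonally
    (∀ φ : G ≃ₘ^ω⟮𝓘(ℂ, E), 𝓘(ℂ, Fin (Module.finrank ℂ E) → ℂ)⟯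
        (Fin (Module.finrank ℂ E) → ℂ),
      ¬ ComplexNil.ActsDiagonally (ComplexNil.transportedDeckAction Γ φ.toEquiv)) ∧
    -- every connected nilpotent subgroup of `Aut(ℂ)` is commutative
    (∀ H : Subgroup ComplexNil.AutC, IsConnected (H : Set ComplexNil.AutC) → Group.IsNilpotent H →
      ∀ a ∈ H, ∀ b ∈ H, a * b = b * a) := by
  have : IsTopologicalGroup G := topologicalGroup_of_lieGroup 𝓘(ℂ, E) ω
  refine ⟨⟨Γ.isQuotientCoveringMap (isDiscrete_iff_discreteTopology.mpr inferInstance),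
    ComplexNil.isLocalDiffeomorph_mk E Γ⟩, ComplexNil.tangentBundleIsTrivial_quotient E Γ,
    ComplexNil.nonempty_diffeomorph_pi E G, fun φ hφ ↦ hG ?_, fun H _ hH a ha b hb ↦
    ComplexNil.commute_of_isNilpotent_subgroup_AutC H ha hb⟩
  exact ComplexNil.commute_of_commute_discrete_subgroup φ Γ
    (ComplexNil.commute_of_actsDiagonally Γ φ hφ)
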